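/- For $k\in\mathbb Z$ and $x\in\mathbb R$ let $\lambda_k(x)=\left(\frac{ix-1}{ix+1}\right)^k$. For $\alpha\in(0,1)$ and $u:\mathbb R\to\mathbb C$ let $$\mathcal D^{\alpha}[u](x)=\frac1{\Gamma(-\alpha)}\int_{-\infty}^0\frac{u(x+z)-u(x)}{|z|^{1+\alpha}}\,dz,\qquad \overline{\mathcal D^{\alpha}}[u](x)=-\frac1{\Gamma(-\alpha)}\int_0^{\infty}\frac{u(x+z)-u(x)}{z^{1+\alpha}}\,dz$$ be the Weyl–Marchaud derivatives, and for $\alpha\in(0,2)$ let $$(-\Delta)^{\alpha/2}u(x)=c_\alpha\,\mathrm{p.v.}\!\int_{-\infty}^\infty\frac{u(x)-u(x+y)}{|y|^{1+\alpha}}\,dy,\qquad c_\alpha=\alpha\,\frac{2^{\alpha-1}\Gamma(\frac12+\frac\alpha2)}{\sqrt\pi\,\Gamma(1-\frac\alpha2)}.$$ Put $$H_{\alpha,k}(x)=\frac{2|k|\,\Gamma(1+\alpha)}{(i\,\mathrm{sgn}(k)x+1)^{1+\alpha}}\;{}_2F_1\!\left(1-|k|,1+\alpha;2;\frac{2}{i\,\mathrm{sgn}(k)x+1}\right),$$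 where the power is the principal branch, ${}_2F_1$ is the Gaussian hypergeometric series (a finite sum for $k\neq0$), $\mathrm{sgn}(0)=0$, and $H_{\alpha,0}(x)=0$. **Theorem.** Let $k\in\mathbb Z$ and $x\in\mathbb R$. If $\alpha\in(0,1)$, then the integrals defining $\mathcal D^\alpha[\lambda_k](x)$ and $\overline{\mathcal D^\alpha}[\lambda_k](x)$ converge absolutely, the principal value defining $(-\Delta)^{\alpha/2}\lambda_k(x)$ exists, and $$\mathcal D^\alpha[\lambda_k](x)=e^{-i\,\mathrm{sgn}(k)\alpha\frac\pi2}(-\Delta)^{\alpha/2}\lambda_k(x)=-e^{-i\,\mathrm{sgn}(k)\alpha\frac\pi2}H_{\alpha,k}(x),$$ $$\overline{\mathcal D^\alpha}[\lambda_k](x)=-e^{i\,\mathrm{sgn}(k)\alpha\frac\pi2}(-\Delta)^{\alpha/2}\lambda_k(x)=e^{i\,\mathrm{sgn}(k)\alpha\frac\pi2}H_{\alpha,k}(x).$$ If $\alpha\in(1,2)$, then the integrals defining $\mathcal D^{\alpha-1}[\lambda_k]$ and $\overline{\mathcal D^{\alpha-1}}[\lambda_k]$ converge absolutely at every point of $\mathbb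 R$, these functions are differentiable at $x$, the principal value defining $(-\Delta)^{\alpha/2}\lambda_k(x)$ exists, and $$\partial_x\mathcal D^{\alpha-1}[\lambda_k](x)=e^{-i\,\mathrm{sgn}(k)\alpha\frac\pi2}(-\Delta)^{\alpha/2}\lambda_k(x)=-e^{-i\,\mathrm{sgn}(k)\alpha\frac\pi2}H_{\alpha,k}(x),$$ $$\partial_x\overline{\mathcal D^{\alpha-1}}[\lambda_k](x)=e^{i\,\mathrm{sgn}(k)\alpha\frac\pi2}(-\Delta)^{\alpha/2}\lambda_k(x)=-e^{i\,\mathrm{sgn}(k)\alpha\frac\pi2}H_{\alpha,k}(x).$$ -/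

import Mathlib

open Set Filter Topology MeasureTheory

noncomputable section

/-- The complex Higgins functions `λ_k(x) = ((ix - 1)/(ix + 1))^k`, `k ∈ ℤ`. -/
def higgins (k : ℤ) (x : ℝ) : ℂ :=
  ((Complex.I * (x : ℂ) - 1) / (Complex.I * (x : ℂ) + 1)) ^ k

/-- The integrand `(u(x + z) - u(x)) / |z|^(1 + α)` of the Weyl-Marchaud derivatives. -/
def marchaudIntegrand (α : ℝ) (u : ℝ → ℂ) (x z : ℝ) : ℂ :=
  (u (x + z) - u x) / ((|z| ^ (1 + α) : ℝ) : ℂ)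

/-- `𝓓^α[u](x) = (1 / Γ(-α)) ∫_{-∞}^0 (u(x + z) - u(x)) / |z|^(1 + α) dz`, for `α ∈ (0, 1)`. -/
def weylMarchaud (α : ℝ) (u : ℝ → ℂ) (x : ℝ) : ℂ :=
  1 / ((Real.Gamma (-α) : ℝ) : ℂ) * ∫ z in Iio (0 : ℝ), marchaudIntegrand α u x z

/-- The operator written with a bar over `𝓓^α`:
`-(1 / Γ(-α)) ∫_0^∞ (u(x + z) - u(x)) / z^(1 + α) dz`, for `α ∈ (0, 1)`. -/
def weylMarchaudBar (α : ℝ) (u : ℝ → ℂ) (x : ℝ) : ℂ :=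
  -(1 / ((Real.Gamma (-α) : ℝ) : ℂ)) * ∫ z in Ioi (0 : ℝ), marchaudIntegrand α u x z

/-- The integral defining `𝓓^α[u](x)` converges absolutely. -/
def WeylMarchaudConverges (α : ℝ) (u : ℝ → ℂ) (x : ℝ) : Prop :=
  IntegrableOn (marchaudIntegrand α u x) (Iio (0 : ℝ))

/-- The integral defining the barred derivative at `x` converges absolutely. -/
def WeylMarchaudBarConverges (α : ℝ) (u : ℝ → ℂ) (x : ℝ) : Prop :=
  IntegrableOn (marchaudIntegrand α u x) (Ioi (0 : ℝ))

/-- The integral of `f` over `{y : |y| > ε}`. -/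
def truncatedIntegral (f : ℝ → ℂ) (ε : ℝ) : ℂ :=
  ∫ y in {y : ℝ | ε < |y|}, f y

/-- The principal value integral of `f` over `ℝ`, with singularity at `0`, exists. -/
def HasPrincipalValue (f : ℝ → ℂ) : Prop :=
  (∀ ε : ℝ, 0 < ε → IntegrableOn f {y : ℝ | ε < |y|}) ∧
    ∃ l : ℂ, Tendsto (truncatedIntegral f) (𝓝[>] (0 : ℝ)) (𝓝 l)

/-- The principal value integral of `f` over `ℝ`, with singularity at `0`. -/
def principalValue (f : ℝ → ℂ) : ℂ :=
  limUnder (𝓝[>] (0 : ℝ)) (truncatedIntegral f)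

/-- The integrand `(u(x) - u(x + y)) / |y|^(1 + α)` of the fractional Laplacian. -/
def fracLaplacianIntegrand (α : ℝ) (u : ℝ → ℂ) (x y : ℝ) : ℂ :=
  (u x - u (x + y)) / ((|y| ^ (1 + α) : ℝ) : ℂ)

/-- `c_α = α 2^(α - 1) Γ(1/2 + α/2) / (√π Γ(1 - α/2))`. -/
def fracLaplacianConst (α : ℝ) : ℝ :=
  α * ((2 : ℝ) ^ (α - 1) * Real.Gamma (1 / 2 + α / 2)) /
    (Real.sqrt Real.pi * Real.Gamma (1 - α / 2))

/-- `(-Δ)^(α/2) u(x) = c_α ∫_ℝ (u(x) - u(x + y)) / |y|^(1 + α) dy`, for `α ∈ (0, 2)`, the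
integral being a principal value. -/
def fracLaplacian (α : ℝ) (u : ℝ → ℂ) (x : ℝ) : ℂ :=
  (fracLaplacianConst α : ℂ) * principalValue (fracLaplacianIntegrand α u x)

/-- The principal value defining `(-Δ)^(α/2) u(x)` exists. -/
def FracLaplacianConverges (α : ℝ) (u : ℝ → ℂ) (x : ℝ) : Prop :=
  HasPrincipalValue (fracLaplacianIntegrand α u x)

/-- The phase `e^{i θ}`. -/
def phase (θ : ℝ) : ℂ := Complex.exp (Complex.I * (θ : ℂ))

/-- The base `i sgn(k) x + 1`. -/
def higginsBase (k : ℤ) (x : ℝ) : ℂ :=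
  Complex.I * ((Int.sign k : ℤ) : ℂ) * (x : ℂ) + 1

/-- `2|k| Γ(1 + α) (i sgn(k) x + 1)^(-1 - α) ₂F₁(1 - |k|, 1 + α; 2; 2 / (i sgn(k) x + 1))`,
with the principal branch of the power. For `k = 0` the factor `2|k|` makes the value `0`. -/
def higginsHypergeometric (α : ℝ) (k : ℤ) (x : ℝ) : ℂ :=
  2 * ((|k| : ℤ) : ℂ) * ((Real.Gamma (1 + α) : ℝ) : ℂ) / higginsBase k x ^ (1 + (α : ℂ)) *
    ordinaryHypergeometric (1 - ((|k| : ℤ) : ℂ)) (1 + (α : ℂ)) (2 : ℂ) (2 / higginsBase k x)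

end

noncomputable section

/-! Put `σ = sgn k`, `n = |k|` and `w = iσx + 1`, so `Re w = 1`. Then `λ_k = (1 - 2/w)^n` is a
polynomial in `1/w`, and by linearity everything reduces to one power `w ^ (-a)`.

For `Re w > 0`, `Γ(a) w ^ (-a)` is the Laplace transform of `t ^ (a - 1)`. Moving `x` by `τz` with
`τ = ±1` moves `w` by `cz` with `c = iστ`, which multiplies the Laplace integrand by `exp(-ctz)`.
The Marchaud integral of this exponential is `Γ(-β) (ct) ^ β`. By Fubini, the integral for `w ^
(-a)` is `Γ(-β) c ^ β Γ(a + β) / Γ(a) · w ^ (-(a + β))` (`integral_cpow_sub_div`). The direction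
enters only through `c ^ β = exp(iστβπ/2)`, so both one-sided derivatives are, up to phase and sign,
the same sum `rayHigginsFrac`. Comparing Pochhammer symbols identifies this sum with `-H`
(`higginsHypergeometric_eq`).

For the Laplacian, symmetrization turns the principal value into an absolutely convergent integral
of a second difference. If `α < 1`, it splits into the two Marchaud integrals, whose phases add up
to `2 cos(απ/2)`. If `α > 1`, one integration by parts leads to Marchaud integrals of order `α - 1`
of the derivative, with the same outcome. The constant `c_α` exactly cancels `-2 Γ(-α) cos(απ/2)`
(`fracLaplacianConst_mul`). -/

/-! ### Laplace transforms of powers -/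

theorem integrableOn_rpow_mul_exp_neg_mul {a r : ℝ} (ha : 0 < a) (hr : 0 < r) :
    IntegrableOn (fun t : ℝ => t ^ (a - 1) * Real.exp (-(r * t))) (Ioi 0) := by
  have h := integrableOn_rpow_mul_exp_neg_mul_rpow (p := 1) (s := a - 1) (by linarith) one_pos hr
  simpa [Real.rpow_one] using h

theorem integrableOn_rpow_mul_cexp_neg_mul {a : ℝ} (ha : 0 < a) {w : ℂ} (hw : 0 < w.re) :
    IntegrableOn (fun t : ℝ => ((t ^ (a - 1) : ℝ) : ℂ) * Complex.exp (-(w * t))) (Ioi 0) := by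
  refine (integrableOn_rpow_mul_exp_neg_mul ha hw).mono' ?_ ?_
  · exact Measurable.aestronglyMeasurable (by fun_prop)
  · filter_upwards [ae_restrict_mem measurableSet_Ioi] with t ht
    rw [norm_mul, Complex.norm_real, Complex.norm_exp, Real.norm_of_nonneg
      (Real.rpow_nonneg (le_of_lt ht) _)]
    simp

theorem hasDerivAt_ofReal_rpow (a : ℝ) {t : ℝ} (ht : 0 < t) :
    HasDerivAt (fun t : ℝ => ((t ^ a : ℝ) : ℂ)) ((a * t ^ (a - 1) : ℝ) : ℂ) t :=
  (Real.hasDerivAt_rpow_const (Or.inl ht.ne')).ofReal_comp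

theorem hasDerivAt_cexp_neg_mul (w : ℂ) (t : ℝ) :
    HasDerivAt (fun t : ℝ => Complex.exp (-(w * t))) (-w * Complex.exp (-(w * t))) t := by
  have h : HasDerivAt (fun t : ℝ => -(w * (t : ℂ))) (-w) t := by
    simpa using! ((hasDerivAt_id t).ofReal_comp.const_mul w).fun_neg
  simpa [mul_comm] using h.cexp

/-- Integration by parts for the Laplace transform of a power. -/
theorem mul_integral_rpow_mul_cexp_neg_mul {a : ℝ} (ha : 0 < a) {w : ℂ} (hw : 0 < w.re) :
    w * ∫ t in Ioi (0 : ℝ), ((t ^ a : ℝ) : ℂ) * Complex.exp (-(w * t)) =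
      a * ∫ t in Ioi (0 : ℝ), ((t ^ (a - 1) : ℝ) : ℂ) * Complex.exp (-(w * t)) := by
  have h1 := integrableOn_rpow_mul_cexp_neg_mul ha hw
  have h2 := integrableOn_rpow_mul_cexp_neg_mul (a := a + 1) (by linarith) hw
  simp only [add_sub_cancel_right] at h2
  have key := integral_Ioi_of_hasDerivAt_of_tendsto (a := 0) (m := 0)
    (f := fun t : ℝ => ((t ^ a : ℝ) : ℂ) * Complex.exp (-(w * t)))
    (f' := fun t : ℝ => a * (((t ^ (a - 1) : ℝ) : ℂ) * Complex.exp (-(w * t))) -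
      w * (((t ^ a : ℝ) : ℂ) * Complex.exp (-(w * t)))) ?_ ?_
    ((h1.const_mul _).sub (h2.const_mul _)) ?_
  · rw [integral_sub (h1.const_mul _) (h2.const_mul _), integral_const_mul,
      integral_const_mul] at key
    simp only [Real.zero_rpow ha.ne', Complex.ofReal_zero, zero_mul, sub_zero] at key
    exact (sub_eq_zero.mp key).symm
  · refine Continuous.continuousWithinAt ?_
    have : Continuous fun t : ℝ => t ^ a := Real.continuous_rpow_const ha.le
    fun_prop
  · intro t ht
    refine ((hasDerivAt_ofReal_rpow a ht).mul (hasDerivAt_cexp_neg_mul w t)).congr_deriv ?_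
    push_cast
    ring
  · rw [tendsto_zero_iff_norm_tendsto_zero]
    refine (tendsto_rpow_mul_exp_neg_mul_atTop_nhds_zero a w.re hw).congr' ?_
    filter_upwards [eventually_gt_atTop 0] with t ht
    rw [norm_mul, Complex.norm_real, Complex.norm_exp, Real.norm_of_nonneg
      (Real.rpow_nonneg (le_of_lt ht) _)]
    simp

theorem hasDerivAt_integral_rpow_mul_cexp_neg_mul {a : ℝ} (ha : 0 < a) {w : ℂ} (hw : 0 < w.re) :
    HasDerivAt (fun w : ℂ => ∫ t in Ioi (0 : ℝ), ((t ^ (a - 1) : ℝ) : ℂ) * Complex.exp (-(w * t)))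
      (-∫ t in Ioi (0 : ℝ), ((t ^ a : ℝ) : ℂ) * Complex.exp (-(w * t))) w := by
  -- On this half-plane `exp(-t Re w / 2)` dominates all the exponentials at once.
  have hs : {z : ℂ | w.re / 2 < z.re} ∈ 𝓝 w :=
    (isOpen_lt continuous_const Complex.continuous_re).mem_nhds (by simp; linarith)
  have hb := integrableOn_rpow_mul_exp_neg_mul (a := a + 1) (r := w.re / 2) (by linarith)
    (by linarith)
  simp only [add_sub_cancel_right] at hb
  have key := hasDerivAt_integral_of_dominated_loc_of_deriv_le (μ := volume.restrict (Ioi (0 : ℝ)))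
    (F := fun (w : ℂ) (t : ℝ) => ((t ^ (a - 1) : ℝ) : ℂ) * Complex.exp (-(w * t)))
    (F' := fun (w : ℂ) (t : ℝ) => -(((t ^ a : ℝ) : ℂ) * Complex.exp (-(w * t))))
    (bound := fun t : ℝ => t ^ a * Real.exp (-(w.re / 2 * t))) hs
    (.of_forall fun z => Measurable.aestronglyMeasurable (by fun_prop))
    (integrableOn_rpow_mul_cexp_neg_mul ha hw)
    (Measurable.aestronglyMeasurable (by fun_prop)) ?_ hb ?_
  · rw [← integral_neg]
    exact key.2
  · filter_upwards [ae_restrict_mem measurableSet_Ioi] with t (ht : 0 < t) z (hz : _ < _)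
    rw [norm_neg, norm_mul, Complex.norm_real, Complex.norm_exp, Real.norm_of_nonneg
      (Real.rpow_nonneg (le_of_lt ht) _)]
    gcongr
    simp
    gcongr
  · filter_upwards [ae_restrict_mem measurableSet_Ioi] with t (ht : 0 < t) z _
    have h : HasDerivAt (fun z : ℂ => -(z * (t : ℂ))) (-t) z := by
      simpa using! ((hasDerivAt_id z).mul_const (t : ℂ)).fun_neg
    refine (h.cexp.const_mul _).congr_deriv ?_
    have : t ^ a = t ^ (a - 1) * t := by
      rw [← Real.rpow_add_one ht.ne']; ring_nf
    rw [this]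
    push_cast
    ring

/-- The Laplace transform of a power, on the open right half-plane. -/
theorem integral_rpow_mul_cexp_neg_mul {a : ℝ} (ha : 0 < a) {w : ℂ} (hw : 0 < w.re) :
    ∫ t in Ioi (0 : ℝ), ((t ^ (a - 1) : ℝ) : ℂ) * Complex.exp (-(w * t)) =
      Real.Gamma a * w ^ (-(a : ℂ)) := by
  set L : ℂ → ℂ := fun w => ∫ t in Ioi (0 : ℝ), ((t ^ (a - 1) : ℝ) : ℂ) * Complex.exp (-(w * t))
    with hL
  have hslit : ∀ z : ℂ, 0 < z.re → z ∈ Complex.slitPlane := fun z hz => Or.inl hz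
  -- Integration by parts says `z L'(z) = -a L(z)`, so `L(z) z ^ a` is constant on the half-plane;
  -- at `z = 1` it is Euler's integral for `Γ(a)`.
  have hd : ∀ z : ℂ, 0 < z.re → HasDerivAt (fun z => L z * z ^ (a : ℂ)) 0 z := by
    intro z hz
    have hz0 : z ≠ 0 := by rintro rfl; simp at hz
    have h1 := hasDerivAt_integral_rpow_mul_cexp_neg_mul ha hz
    have h2 : HasDerivAt (fun z : ℂ => z ^ (a : ℂ)) (a * z ^ ((a : ℂ) - 1)) z :=
      (hasDerivAt_id z).cpow_const (c := (a : ℂ)) (hslit z hz) |>.congr_deriv (by simp)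
    refine (h1.mul h2).congr_deriv ?_
    have h3 := mul_integral_rpow_mul_cexp_neg_mul ha hz
    rw [Complex.cpow_sub _ _ hz0, Complex.cpow_one]
    field_simp
    linear_combination (-z ^ (a : ℂ)) * h3
  have hopen : IsOpen {z : ℂ | 0 < z.re} := isOpen_lt continuous_const Complex.continuous_re
  have hconn : IsPreconnected {z : ℂ | 0 < z.re} := (convex_halfSpace_re_gt 0).isPreconnected
  obtain ⟨c, hc⟩ := hopen.exists_is_const_of_deriv_eq_zero hconn
    (f := fun z => L z * z ^ (a : ℂ))
    (fun z hz => (hd z hz).differentiableAt.differentiableWithinAt) (fun z hz => (hd z hz).deriv)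
  have hone : L 1 = Real.Gamma a := by
    rw [Real.Gamma_eq_integral ha, ← integral_complex_ofReal]
    refine setIntegral_congr_fun measurableSet_Ioi fun t _ => ?_
    push_cast
    ring_nf
  have h1 : c = Real.Gamma a := by
    rw [← hc 1 (by simp), hone]
    simp
  have hw0 : w ≠ 0 := by rintro rfl; simp at hw
  have h2 : L w * w ^ (a : ℂ) = Real.Gamma a := (hc w hw).trans h1
  rw [Complex.cpow_neg, ← h2, mul_inv_cancel_right₀]
  simp [Complex.cpow_eq_zero_iff, hw0]

/-! ### The Marchaud integral of an exponential -/

/-- The common majorant: `p = 1` serves first differences and `p = 2` second differences. It is `z ^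
(p - 1 - β)` near `0` and `z ^ (-1 - β)` at infinity. -/
theorem integrableOn_min_one_rpow_div_rpow {p β : ℝ} (h0 : 0 < β) (h1 : β < p) :
    IntegrableOn (fun z : ℝ => min 1 (z ^ p) / z ^ (1 + β)) (Ioi 0) := by
  have hp : 0 ≤ p := by linarith
  rw [← Ioc_union_Ioi_eq_Ioi zero_le_one]
  refine IntegrableOn.union ?_ ?_
  · have h : IntegrableOn (fun z : ℝ => z ^ (p - (1 + β))) (Ioc 0 1) :=
      (intervalIntegrable_iff_integrableOn_Ioc_of_le zero_le_one).mp
        (intervalIntegral.intervalIntegrable_rpow' (by linarith))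
    refine h.congr_fun (fun z hz => ?_) measurableSet_Ioc
    simp only [min_eq_right (Real.rpow_le_one hz.1.le hz.2 hp), Real.rpow_sub hz.1]
  · have h : IntegrableOn (fun z : ℝ => z ^ (-(1 + β))) (Ioi 1) :=
      integrableOn_Ioi_rpow_of_lt (by linarith) one_pos
    refine h.congr_fun (fun z (hz : 1 < z) => ?_) measurableSet_Ioi
    have hz0 : 0 ≤ z := by linarith
    simp only [min_eq_left (Real.one_le_rpow hz.le hp), Real.rpow_neg hz0, one_div]

theorem integrableOn_min_one_div_rpow {β : ℝ} (h0 : 0 < β) (h1 : β < 1) :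
    IntegrableOn (fun z : ℝ => min 1 z / z ^ (1 + β)) (Ioi 0) := by
  simpa only [Real.rpow_one] using integrableOn_min_one_rpow_div_rpow h0 h1

theorem norm_cexp_sub_one_le_min {w : ℂ} (hw : w.re ≤ 0) :
    ‖Complex.exp w - 1‖ ≤ 2 * min 1 ‖w‖ := by
  rcases le_total ‖w‖ 1 with h | h
  · rw [min_eq_right h]
    exact Complex.norm_exp_sub_one_le h
  · rw [min_eq_left h]
    calc ‖Complex.exp w - 1‖ ≤ ‖Complex.exp w‖ + ‖(1 : ℂ)‖ := norm_sub_le _ _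
      _ ≤ 2 * 1 := by
        rw [Complex.norm_exp, norm_one]
        have := Real.exp_le_one_iff.mpr hw
        linarith

theorem norm_cexp_neg_mul_sub_one_le {s : ℂ} (hs : 0 ≤ s.re) {C z : ℝ} (hC : 1 ≤ C)
    (hsC : ‖s‖ ≤ C) (hz : 0 ≤ z) :
    ‖Complex.exp (-(s * z)) - 1‖ ≤ 2 * C * min 1 z := by
  have h := norm_cexp_sub_one_le_min (w := -(s * z)) (by simp; positivity)
  refine h.trans ?_
  rw [mul_assoc]
  gcongr
  rw [norm_neg, norm_mul, Complex.norm_real, Real.norm_of_nonneg hz, mul_min_of_nonneg _ _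
    (by linarith)]
  gcongr
  linarith

theorem norm_cexp_neg_mul_sub_one_div_le {β : ℝ} {s : ℂ} (hs : 0 ≤ s.re) {C z : ℝ} (hC : 1 ≤ C)
    (hsC : ‖s‖ ≤ C) (hz : 0 < z) :
    ‖(Complex.exp (-(s * z)) - 1) / ((z ^ (1 + β) : ℝ) : ℂ)‖ ≤
      2 * C * (min 1 z / z ^ (1 + β)) := by
  rw [norm_div, Complex.norm_real, Real.norm_of_nonneg (Real.rpow_nonneg hz.le _), ← mul_div_assoc]
  gcongr
  exact norm_cexp_neg_mul_sub_one_le hs hC hsC hz.le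

theorem integrableOn_cexp_neg_mul_sub_one_div {β : ℝ} (h0 : 0 < β) (h1 : β < 1) {s : ℂ}
    (hs : 0 ≤ s.re) :
    IntegrableOn (fun z : ℝ => (Complex.exp (-(s * z)) - 1) / ((z ^ (1 + β) : ℝ) : ℂ)) (Ioi 0) := by
  refine ((integrableOn_min_one_div_rpow h0 h1).const_mul (2 * max 1 ‖s‖)).mono'
    (Measurable.aestronglyMeasurable (by fun_prop)) ?_
  filter_upwards [ae_restrict_mem measurableSet_Ioi] with z hz
  exact norm_cexp_neg_mul_sub_one_div_le hs (le_max_left _ _) (le_max_right _ _) hz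

theorem Gamma_neg_eq {β : ℝ} (h0 : 0 < β) : Real.Gamma (1 - β) = -β * Real.Gamma (-β) := by
  rw [← Real.Gamma_add_one (by linarith : -β ≠ 0)]
  ring_nf

/-- Integrating by parts against the antiderivative `-z ^ (-β) / β` leaves the Laplace transform of
`z ^ (-β)`, that is, the exponent `a = 1 - β`. -/
theorem integral_cexp_neg_mul_sub_one_div_of_re_pos {β : ℝ} (h0 : 0 < β) (h1 : β < 1) {s : ℂ}
    (hs : 0 < s.re) :
    ∫ z in Ioi (0 : ℝ), (Complex.exp (-(s * z)) - 1) / ((z ^ (1 + β) : ℝ) : ℂ) =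
      Real.Gamma (-β) * s ^ (β : ℂ) := by
  have hs0 : s ≠ 0 := by rintro rfl; simp at hs
  have hβ : (β : ℂ) ≠ 0 := by exact_mod_cast h0.ne'
  have hI := integrableOn_cexp_neg_mul_sub_one_div h0 h1 hs.le
  have hL := integral_rpow_mul_cexp_neg_mul (a := 1 - β) (by linarith) hs
  have hLi := integrableOn_rpow_mul_cexp_neg_mul (a := 1 - β) (by linarith) hs
  have e : (1 - β - 1 : ℝ) = -β := by ring
  rw [e] at hL hLi
  have key := integral_Ioi_mul_deriv_eq_deriv_mul (a := 0) (a' := 0) (b' := 0)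
    (u := fun z : ℝ => Complex.exp (-(s * z)) - 1)
    (u' := fun z : ℝ => -s * Complex.exp (-(s * z)))
    (v := fun z : ℝ => -(β : ℂ)⁻¹ * ((z ^ (-β) : ℝ) : ℂ))
    (v' := fun z : ℝ => 1 / ((z ^ (1 + β) : ℝ) : ℂ))
    (fun z _ => (hasDerivAt_cexp_neg_mul s z).sub_const 1) ?_ ?_ ?_ ?_ ?_
  · simp only [mul_one_div] at key
    rw [key]
    have : ∀ z : ℝ, -s * Complex.exp (-(s * z)) * (-(β : ℂ)⁻¹ * ((z ^ (-β) : ℝ) : ℂ)) =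
        s * (β : ℂ)⁻¹ * (((z ^ (-β) : ℝ) : ℂ) * Complex.exp (-(s * z))) := fun z => by ring
    simp only [this]
    rw [integral_const_mul, hL, Gamma_neg_eq h0]
    have : s ^ (β : ℂ) = s * s ^ (-((1 - β : ℝ) : ℂ)) := by
      nth_rewrite 2 [← Complex.cpow_one s]
      rw [← Complex.cpow_add _ _ hs0]
      push_cast
      ring_nf
    rw [this]
    push_cast
    field_simp
    ring
  · intro z (hz : 0 < z)
    refine ((hasDerivAt_ofReal_rpow (-β) hz).const_mul _).congr_deriv ?_
    rw [show -β - 1 = -(1 + β) by ring, Real.rpow_neg hz.le]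
    push_cast
    field_simp
  · simpa only [Pi.mul_def, mul_one_div] using hI
  · refine IntegrableOn.congr_fun (hLi.const_mul (s * (β : ℂ)⁻¹)) (fun z _ => ?_) measurableSet_Ioi
    simp only [Pi.mul_apply]
    ring
  · have hlim : Tendsto (fun z : ℝ => 2 * max 1 ‖s‖ * β⁻¹ * z ^ (1 - β)) (𝓝[>] 0) (𝓝 0) := by
      have : Continuous fun z : ℝ => 2 * max 1 ‖s‖ * β⁻¹ * z ^ (1 - β) :=
        continuous_const.mul (Real.continuous_rpow_const (by linarith))
      have h := this.tendsto 0
      simp only [Real.zero_rpow (by linarith : 1 - β ≠ 0), mul_zero] at h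
      exact h.mono_left nhdsWithin_le_nhds
    refine squeeze_zero_norm' ?_ hlim
    filter_upwards [self_mem_nhdsWithin] with z (hz : 0 < z)
    have hb := norm_cexp_neg_mul_sub_one_le hs.le (le_max_left 1 ‖s‖) (le_max_right _ _) hz.le
    simp only [Pi.mul_apply, norm_mul, norm_neg, norm_inv, Complex.norm_real,
      Real.norm_of_nonneg h0.le, Real.norm_of_nonneg (Real.rpow_nonneg hz.le (-β))]
    have e2 : z ^ (1 - β) = z * z ^ (-β) := by
      rw [sub_eq_add_neg, Real.rpow_add hz, Real.rpow_one]
    rw [e2]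
    calc _ ≤ (2 * max 1 ‖s‖ * z) * (β⁻¹ * z ^ (-β)) := by
          gcongr
          exact hb.trans (by gcongr; exact min_le_right _ _)
      _ = _ := by ring
  · have hlim : Tendsto (fun z : ℝ => 2 * max 1 ‖s‖ * β⁻¹ * z ^ (-β)) atTop (𝓝 0) := by
      simpa using (tendsto_rpow_neg_atTop h0).const_mul (2 * max 1 ‖s‖ * β⁻¹)
    refine squeeze_zero_norm' ?_ hlim
    filter_upwards [eventually_gt_atTop 0] with z (hz : 0 < z)
    have hb := norm_cexp_neg_mul_sub_one_le hs.le (le_max_left 1 ‖s‖) (le_max_right _ _) hz.le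
    simp only [Pi.mul_apply, norm_mul, norm_neg, norm_inv, Complex.norm_real,
      Real.norm_of_nonneg h0.le, Real.norm_of_nonneg (Real.rpow_nonneg hz.le (-β))]
    calc _ ≤ (2 * max 1 ‖s‖ * 1) * (β⁻¹ * z ^ (-β)) := by
          gcongr
          exact hb.trans (by gcongr; exact min_le_left _ _)
      _ = _ := by ring

/-- The Marchaud integral of an exponential, on the closed right half-plane without the origin. -/
theorem integral_cexp_neg_mul_sub_one_div {β : ℝ} (h0 : 0 < β) (h1 : β < 1) {s : ℂ}
    (hs : 0 ≤ s.re) (hs0 : s ≠ 0) :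
    ∫ z in Ioi (0 : ℝ), (Complex.exp (-(s * z)) - 1) / ((z ^ (1 + β) : ℝ) : ℂ) =
      Real.Gamma (-β) * s ^ (β : ℂ) := by
  have hslit : s ∈ Complex.slitPlane := by
    rcases hs.lt_or_eq with h | h
    · exact Or.inl h
    · exact Or.inr fun hi => hs0 (Complex.ext h.symm hi)
  -- The boundary case `Re s = 0`, the one needed later, is reached from `s + ε` by dominated
  -- convergence and continuity of the principal power at `s`.
  have hseq : Tendsto (fun ε : ℝ => s + (ε : ℂ)) (𝓝[>] 0) (𝓝 s) := by
    have : Continuous fun ε : ℝ => s + (ε : ℂ) := by fun_prop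
    simpa using (this.tendsto 0).mono_left nhdsWithin_le_nhds
  have hsmall : ∀ᶠ ε : ℝ in 𝓝[>] 0, 0 < ε ∧ ε < 1 := Ioo_mem_nhdsGT one_pos
  have hR : Tendsto (fun ε : ℝ => (Real.Gamma (-β) : ℂ) * (s + (ε : ℂ)) ^ (β : ℂ)) (𝓝[>] 0)
      (𝓝 (Real.Gamma (-β) * s ^ (β : ℂ))) :=
    ((continuousAt_cpow_const hslit).tendsto.comp hseq).const_mul _
  refine tendsto_nhds_unique ?_ hR
  have hD := tendsto_integral_filter_of_dominated_convergence
    (μ := volume.restrict (Ioi (0 : ℝ))) (l := 𝓝[>] (0 : ℝ))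
    (F := fun (ε : ℝ) (z : ℝ) =>
      (Complex.exp (-((s + (ε : ℂ)) * z)) - 1) / ((z ^ (1 + β) : ℝ) : ℂ))
    (f := fun z : ℝ => (Complex.exp (-(s * z)) - 1) / ((z ^ (1 + β) : ℝ) : ℂ))
    (fun z : ℝ => 2 * (1 + ‖s‖) * (min 1 z / z ^ (1 + β)))
    (.of_forall fun ε => Measurable.aestronglyMeasurable (by fun_prop)) ?_
    ((integrableOn_min_one_div_rpow h0 h1).const_mul _) ?_
  · refine hD.congr' ?_
    filter_upwards [hsmall] with ε hε
    exact integral_cexp_neg_mul_sub_one_div_of_re_pos h0 h1 (by simp; linarith)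
  · filter_upwards [hsmall] with ε hε
    filter_upwards [ae_restrict_mem measurableSet_Ioi] with z hz
    refine norm_cexp_neg_mul_sub_one_div_le (by simp; linarith) (by simp) ?_ hz
    refine (norm_add_le _ _).trans ?_
    rw [Complex.norm_real, Real.norm_of_nonneg hε.1.le]
    linarith
  · refine .of_forall fun z => ?_
    have : Continuous fun w : ℂ => (Complex.exp (-(w * z)) - 1) / ((z ^ (1 + β) : ℝ) : ℂ) := by
      fun_prop
    exact (this.tendsto s).comp hseq

/-! ### The Marchaud integral of a power -/

/-- Since `|exp(-ctz) - 1| ≤ 2 (1 + |c| t) min(1, z)`, the kernel is dominated by a product of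
integrable functions of `z` and of `t`. This is the hypothesis of Fubini. -/
theorem integrable_marchaud_laplace_kernel {a β : ℝ} (ha : 0 < a) (h0 : 0 < β) (h1 : β < 1)
    {w c : ℂ} (hw : 0 < w.re) (hc : 0 ≤ c.re) :
    Integrable (Function.uncurry fun z t : ℝ => ((t ^ (a - 1) : ℝ) : ℂ) * Complex.exp (-(w * t)) *
      ((Complex.exp (-(c * t * z)) - 1) / ((z ^ (1 + β) : ℝ) : ℂ)))
      ((volume.restrict (Ioi (0 : ℝ))).prod (volume.restrict (Ioi (0 : ℝ)))) := by
  have hg : IntegrableOn (fun t : ℝ => t ^ (a - 1) * Real.exp (-(w.re * t)) * (2 * (1 + ‖c‖ * t)))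
      (Ioi 0) := by
    have g1 := integrableOn_rpow_mul_exp_neg_mul ha hw
    have g2 := integrableOn_rpow_mul_exp_neg_mul (a := a + 1) (by linarith) hw
    refine IntegrableOn.congr_fun ((g1.const_mul 2).add (g2.const_mul (2 * ‖c‖)))
      (fun t (ht : 0 < t) => ?_) measurableSet_Ioi
    have : t ^ (a + 1 - 1) = t ^ (a - 1) * t := by
      rw [← Real.rpow_add_one ht.ne']; ring_nf
    simp only [Pi.add_apply, this]
    ring
  refine ((integrableOn_min_one_div_rpow h0 h1).integrable.mul_prod hg.integrable).mono'
    (Measurable.aestronglyMeasurable (by simp only [Function.uncurry_def]; fun_prop)) ?_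
  rw [Measure.prod_restrict]
  filter_upwards [ae_restrict_mem (measurableSet_Ioi.prod measurableSet_Ioi)] with p hp
  obtain ⟨hz : 0 < p.1, ht : 0 < p.2⟩ := hp
  simp only [Function.uncurry_def]
  rw [norm_mul, norm_mul, Complex.norm_real, Complex.norm_exp,
    Real.norm_of_nonneg (Real.rpow_nonneg ht.le _)]
  have hb := norm_cexp_neg_mul_sub_one_div_le (β := β) (s := c * p.2) (C := 1 + ‖c‖ * p.2)
    (by simp; positivity) (by have : 0 ≤ ‖c‖ * p.2 := by positivity
                              linarith)
    (by rw [norm_mul, Complex.norm_real, Real.norm_of_nonneg ht.le]; linarith) hz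
  have hre : (-(w * (p.2 : ℂ))).re = -(w.re * p.2) := by simp
  rw [hre]
  calc _ ≤ p.2 ^ (a - 1) * Real.exp (-(w.re * p.2)) *
        (2 * (1 + ‖c‖ * p.2) * (min 1 p.1 / p.1 ^ (1 + β))) := by gcongr
    _ = _ := by ring

theorem integral_laplace_kernel {a β : ℝ} (ha : 0 < a) {w c : ℂ} (hw : 0 < w.re) (hc : 0 ≤ c.re)
    {z : ℝ} (hz : 0 < z) :
    ∫ t in Ioi (0 : ℝ), ((t ^ (a - 1) : ℝ) : ℂ) * Complex.exp (-(w * t)) *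
      ((Complex.exp (-(c * t * z)) - 1) / ((z ^ (1 + β) : ℝ) : ℂ)) =
    Real.Gamma a *
      (((w + c * z) ^ (-(a : ℂ)) - w ^ (-(a : ℂ))) / ((z ^ (1 + β) : ℝ) : ℂ)) := by
  have hwc : 0 < (w + c * z).re := by
    simp; positivity
  have i1 := integrableOn_rpow_mul_cexp_neg_mul ha hwc
  have i2 := integrableOn_rpow_mul_cexp_neg_mul ha hw
  rw [← mul_div_assoc, mul_sub, ← integral_rpow_mul_cexp_neg_mul ha hwc,
    ← integral_rpow_mul_cexp_neg_mul ha hw, ← integral_sub i1 i2, ← integral_div]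
  refine setIntegral_congr_fun measurableSet_Ioi fun t _ => ?_
  have : Complex.exp (-((w + c * z) * t)) =
      Complex.exp (-(w * t)) * Complex.exp (-(c * t * z)) := by
    rw [← Complex.exp_add]
    ring_nf
  simp only [this]
  ring

theorem integrableOn_cpow_sub_div {a β : ℝ} (ha : 0 < a) (h0 : 0 < β) (h1 : β < 1)
    {w c : ℂ} (hw : 0 < w.re) (hc : 0 ≤ c.re) :
    IntegrableOn (fun z : ℝ => ((w + c * z) ^ (-(a : ℂ)) - w ^ (-(a : ℂ))) /
      ((z ^ (1 + β) : ℝ) : ℂ)) (Ioi 0) := by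
  have hΓ : (Real.Gamma a : ℂ) ≠ 0 := by exact_mod_cast (Real.Gamma_pos_of_pos ha).ne'
  have h := (integrable_marchaud_laplace_kernel ha h0 h1 hw hc).integral_prod_left
  refine IntegrableOn.congr_fun (h.const_mul (Real.Gamma a : ℂ)⁻¹) (fun z (hz : 0 < z) => ?_)
    measurableSet_Ioi
  simp only [Function.uncurry_apply_pair]
  rw [integral_laplace_kernel ha hw hc hz, inv_mul_cancel_left₀ hΓ]

/-- A positive real factor does not change the argument, so no branch correction appears. -/
theorem cpow_mul_ofReal {c : ℂ} (hc : c ≠ 0) {t : ℝ} (ht : 0 < t) (r : ℂ) :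
    (c * t) ^ r = c ^ r * (t : ℂ) ^ r := by
  have ht0 : (t : ℂ) ≠ 0 := by exact_mod_cast ht.ne'
  rw [Complex.cpow_def_of_ne_zero (mul_ne_zero hc ht0), Complex.cpow_def_of_ne_zero hc,
    Complex.cpow_def_of_ne_zero ht0, Complex.log_mul_ofReal t ht c hc, Complex.ofReal_log ht.le,
    ← Complex.exp_add]
  ring_nf

/-- The Marchaud integral of a power, along the ray `w + c z`. -/
theorem integral_cpow_sub_div {a β : ℝ} (ha : 0 < a) (h0 : 0 < β) (h1 : β < 1)
    {w c : ℂ} (hw : 0 < w.re) (hc : 0 ≤ c.re) (hc0 : c ≠ 0) :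
    ∫ z in Ioi (0 : ℝ), ((w + c * z) ^ (-(a : ℂ)) - w ^ (-(a : ℂ))) / ((z ^ (1 + β) : ℝ) : ℂ) =
      Real.Gamma (-β) * c ^ (β : ℂ) *
        (Real.Gamma (a + β) / Real.Gamma a * w ^ (-((a : ℂ) + β))) := by
  have hΓ : (Real.Gamma a : ℂ) ≠ 0 := by exact_mod_cast (Real.Gamma_pos_of_pos ha).ne'
  -- Integrating in `t` first gives the difference of powers of `w`; integrating in `z` first gives
  -- `Γ(-β) (ct) ^ β`, which raises the Laplace exponent from `a` to `a + β`.
  have hswap := integral_integral_swap (integrable_marchaud_laplace_kernel ha h0 h1 hw hc)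
  have hleft : ∀ z ∈ Ioi (0 : ℝ), _ := fun z hz => integral_laplace_kernel (β := β) ha hw hc hz
  rw [setIntegral_congr_fun measurableSet_Ioi hleft, integral_const_mul] at hswap
  have hright : ∀ t ∈ Ioi (0 : ℝ), ∫ z in Ioi (0 : ℝ), ((t ^ (a - 1) : ℝ) : ℂ) *
      Complex.exp (-(w * t)) * ((Complex.exp (-(c * t * z)) - 1) / ((z ^ (1 + β) : ℝ) : ℂ)) =
      Real.Gamma (-β) * c ^ (β : ℂ) *
        (((t ^ (a + β - 1) : ℝ) : ℂ) * Complex.exp (-(w * t))) := by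
    intro t (ht : 0 < t)
    have ht0 : (t : ℂ) ≠ 0 := by exact_mod_cast ht.ne'
    rw [integral_const_mul, integral_cexp_neg_mul_sub_one_div h0 h1 (by simp; positivity)
      (mul_ne_zero hc0 ht0), cpow_mul_ofReal hc0 ht, ← Complex.ofReal_cpow ht.le,
      show a + β - 1 = (a - 1) + β by ring, Real.rpow_add ht]
    push_cast
    ring
  rw [setIntegral_congr_fun measurableSet_Ioi hright, integral_const_mul,
    integral_rpow_mul_cexp_neg_mul (a := a + β) (by linarith) hw] at hswap
  rw [← mul_right_inj' hΓ, hswap]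
  push_cast
  field_simp

/-! ### Calculus of one-sided Marchaud integrals -/

/-- Both one-sided Marchaud integrals of order `β` of `u` converge absolutely, and they are the
multiples `Γ(-β) e^{± i σ β π / 2}` of `A`. -/
def HasMarchaudIntegrals (σ β : ℝ) (u A : ℝ → ℂ) : Prop :=
  ∀ τ : ℝ, (τ = 1 ∨ τ = -1) → ∀ x : ℝ,
    IntegrableOn (fun z : ℝ => (u (x + τ * z) - u x) / ((z ^ (1 + β) : ℝ) : ℂ)) (Ioi 0) ∧
    ∫ z in Ioi (0 : ℝ), (u (x + τ * z) - u x) / ((z ^ (1 + β) : ℝ) : ℂ) =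
      Real.Gamma (-β) * phase (σ * τ * β * (Real.pi / 2)) * A x

namespace HasMarchaudIntegrals

variable {σ β : ℝ} {u v A B : ℝ → ℂ}

theorem const (c : ℂ) : HasMarchaudIntegrals σ β (fun _ => c) (fun _ => 0) := by
  intro τ _ x
  simp [IntegrableOn]

theorem add (hu : HasMarchaudIntegrals σ β u A) (hv : HasMarchaudIntegrals σ β v B) :
    HasMarchaudIntegrals σ β (fun x => u x + v x) (fun x => A x + B x) := by
  intro τ hτ x
  have hi := (hu τ hτ x).1.add (hv τ hτ x).1
  have e : (fun z : ℝ => (u (x + τ * z) + v (x + τ * z) - (u x + v x)) /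
      ((z ^ (1 + β) : ℝ) : ℂ)) = fun z : ℝ => (u (x + τ * z) - u x) / ((z ^ (1 + β) : ℝ) : ℂ) +
        (v (x + τ * z) - v x) / ((z ^ (1 + β) : ℝ) : ℂ) := by
    funext z
    ring
  rw [e]
  refine ⟨hi, ?_⟩
  rw [integral_add (hu τ hτ x).1 (hv τ hτ x).1, (hu τ hτ x).2, (hv τ hτ x).2]
  ring

theorem const_mul (hu : HasMarchaudIntegrals σ β u A) (c : ℂ) :
    HasMarchaudIntegrals σ β (fun x => c * u x) (fun x => c * A x) := by
  intro τ hτ x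
  have e : (fun z : ℝ => (c * u (x + τ * z) - c * u x) / ((z ^ (1 + β) : ℝ) : ℂ)) =
      fun z : ℝ => c * ((u (x + τ * z) - u x) / ((z ^ (1 + β) : ℝ) : ℂ)) := by
    funext z
    ring
  rw [e]
  refine ⟨(hu τ hτ x).1.const_mul c, ?_⟩
  rw [integral_const_mul, (hu τ hτ x).2]
  ring

theorem sum {ι : Type*} (s : Finset ι) {f F : ι → ℝ → ℂ}
    (h : ∀ i ∈ s, HasMarchaudIntegrals σ β (f i) (F i)) :
    HasMarchaudIntegrals σ β (fun x => ∑ i ∈ s, f i x) (fun x => ∑ i ∈ s, F i x) := by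
  classical
  induction s using Finset.induction_on with
  | empty => simpa using const 0
  | insert i s hi ih =>
    simp only [Finset.sum_insert hi]
    exact (h i (Finset.mem_insert_self i s)).add
      (ih fun j hj => h j (Finset.mem_insert_of_mem hj))

end HasMarchaudIntegrals

/-! ### Powers of the base and their finite sums -/

/-- The base `i σ x + 1`. -/
def rayBase (σ x : ℝ) : ℂ := Complex.I * (σ : ℂ) * (x : ℂ) + 1

theorem rayBase_re (σ x : ℝ) : (rayBase σ x).re = 1 := by simp [rayBase]

theorem rayBase_ne_zero (σ x : ℝ) : rayBase σ x ≠ 0 := fun h => by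
  simpa [h] using rayBase_re σ x

theorem one_le_norm_rayBase (σ x : ℝ) : 1 ≤ ‖rayBase σ x‖ := by
  have := Complex.re_le_norm (rayBase σ x)
  rwa [rayBase_re] at this

theorem rayBase_mem_slitPlane (σ x : ℝ) : rayBase σ x ∈ Complex.slitPlane :=
  Or.inl (by simp [rayBase_re])

theorem hasDerivAt_rayBase (σ x : ℝ) : HasDerivAt (rayBase σ) (Complex.I * σ) x := by
  have h := ((hasDerivAt_id x).ofReal_comp.const_mul (Complex.I * (σ : ℂ))).add_const 1
  exact h.congr_deriv (by simp)

theorem hasDerivAt_rayBase_cpow (σ x : ℝ) (c : ℂ) :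
    HasDerivAt (fun x => rayBase σ x ^ (-c)) (-(Complex.I * σ) * (c * rayBase σ x ^ (-(c + 1)))) x := by
  have h1 : HasDerivAt (fun w : ℂ => w ^ (-c)) (-c * rayBase σ x ^ (-c - 1)) (rayBase σ x) :=
    ((hasDerivAt_id (rayBase σ x)).cpow_const (c := -c) (rayBase_mem_slitPlane σ x)).congr_deriv (by simp)
  refine (h1.comp x (hasDerivAt_rayBase σ x)).congr_deriv ?_
  rw [neg_add']
  ring

/-- The source of all the phases: the principal logarithm of `±i` is `±iπ/2`. -/
theorem I_mul_cpow {ρ : ℝ} (hρ : ρ = 1 ∨ ρ = -1) (β : ℝ) :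
    (Complex.I * ρ) ^ (β : ℂ) = phase (ρ * β * (Real.pi / 2)) := by
  rcases hρ with rfl | rfl
  · rw [Complex.cpow_def_of_ne_zero (by simp), phase]
    simp only [Complex.ofReal_one, mul_one, Complex.log_I]
    push_cast
    ring_nf
  · rw [Complex.cpow_def_of_ne_zero (by simp), phase]
    simp only [Complex.ofReal_neg, Complex.ofReal_one, mul_neg, mul_one, Complex.log_neg_I]
    push_cast
    ring_nf

theorem hasMarchaudIntegrals_rayBase_pow {σ β : ℝ} (hσ : σ = 1 ∨ σ = -1) (h0 : 0 < β)
    (h1 : β < 1) (m : ℕ) :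
    HasMarchaudIntegrals σ β (fun x => rayBase σ x ^ (-(m + 1 : ℂ)))
      (fun x => Real.Gamma (m + 1 + β) / Real.Gamma (m + 1) *
        rayBase σ x ^ (-(m + 1 + β : ℂ))) := by
  intro τ hτ x
  have hρ : σ * τ = 1 ∨ σ * τ = -1 := by
    rcases hσ with rfl | rfl <;> rcases hτ with rfl | rfl <;> simp
  have hρ0 : (Complex.I * ((σ * τ : ℝ) : ℂ)) ≠ 0 := by
    refine mul_ne_zero Complex.I_ne_zero ?_
    rcases hρ with h | h <;> simp [h]
  have hre : 0 ≤ (Complex.I * ((σ * τ : ℝ) : ℂ)).re := by simp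
  have hw : 0 < (rayBase σ x).re := by simp [rayBase_re]
  have ha : (0 : ℝ) < (m : ℝ) + 1 := by positivity
  have e : ∀ z : ℝ, rayBase σ (x + τ * z) =
      rayBase σ x + Complex.I * ((σ * τ : ℝ) : ℂ) * z := fun z => by
    simp only [rayBase]
    push_cast
    ring
  have i1 := integrableOn_cpow_sub_div ha h0 h1 hw hre
  have i2 := integral_cpow_sub_div ha h0 h1 hw hre hρ0
  rw [I_mul_cpow hρ] at i2
  simp only [e]
  push_cast at i1 i2 ⊢
  exact ⟨i1, i2⟩

/-- The coefficients of `(1 - 2 / w) ^ n - 1` in the powers `w ^ (-(m + 1))`. -/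
def higginsCoeff (n m : ℕ) : ℂ := (n.choose (m + 1) : ℂ) * (-2) ^ (m + 1)

/-- `1 + ∑ m < n, higginsCoeff n m * w ^ (-(m + 1))` with `w = i σ x + 1`. -/
def rayHiggins (σ : ℝ) (n : ℕ) (x : ℝ) : ℂ :=
  1 + ∑ m ∈ Finset.range n, higginsCoeff n m * rayBase σ x ^ (-(m + 1 : ℂ))

/-- The derivative of `rayHiggins`. -/
def rayHigginsDeriv (σ : ℝ) (n : ℕ) (x : ℝ) : ℂ :=
  ∑ m ∈ Finset.range n, -(Complex.I * σ) * higginsCoeff n m * (m + 1) *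
    rayBase σ x ^ (-((m + 1 : ℕ) + 1 : ℂ))

/-- The term by term Marchaud derivative of `rayHiggins`, without its phase. -/
def rayHigginsFrac (σ : ℝ) (n : ℕ) (α : ℝ) (x : ℝ) : ℂ :=
  ∑ m ∈ Finset.range n, higginsCoeff n m * (Real.Gamma (m + 1 + α) / Real.Gamma (m + 1) *
    rayBase σ x ^ (-(m + 1 + α : ℂ)))

/-- The condition on `σ` is only asked for `n ≠ 0` because `k = 0` gives `σ = 0`; the sum is then
empty. -/
theorem hasMarchaudIntegrals_rayHiggins {σ β : ℝ} {n : ℕ} (hσ : n ≠ 0 → σ = 1 ∨ σ = -1)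
    (h0 : 0 < β) (h1 : β < 1) :
    HasMarchaudIntegrals σ β (rayHiggins σ n) (rayHigginsFrac σ n β) := by
  have h := (HasMarchaudIntegrals.const (σ := σ) (β := β) 1).add
    (HasMarchaudIntegrals.sum (Finset.range n) fun m hm =>
      (hasMarchaudIntegrals_rayBase_pow (hσ (by rintro rfl; simp at hm)) h0 h1 m).const_mul
        (higginsCoeff n m))
  simp only [zero_add] at h
  exact h

theorem hasMarchaudIntegrals_rayHigginsDeriv {σ β : ℝ} {n : ℕ} (hσ : n ≠ 0 → σ = 1 ∨ σ = -1)
    (h0 : 0 < β) (h1 : β < 1) :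
    HasMarchaudIntegrals σ β (rayHigginsDeriv σ n)
      (fun x => -(Complex.I * σ) * rayHigginsFrac σ n (β + 1) x) := by
  have h := HasMarchaudIntegrals.sum (σ := σ) (β := β) (Finset.range n) fun m hm =>
      (hasMarchaudIntegrals_rayBase_pow (hσ (by rintro rfl; simp at hm)) h0 h1 (m + 1)).const_mul
        (-(Complex.I * σ) * higginsCoeff n m * (m + 1))
  convert! h using 2 with x
  simp only [rayHigginsFrac, Finset.mul_sum]
  refine Finset.sum_congr rfl fun m _ => ?_
  have hm : ((m : ℝ) + 1) ≠ 0 := by positivity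
  have hmc : ((m : ℂ) + 1) ≠ 0 := by exact_mod_cast hm
  have hΓ : (Real.Gamma (m + 1) : ℂ) ≠ 0 := by
    exact_mod_cast (Real.Gamma_pos_of_pos (by positivity : (0 : ℝ) < m + 1)).ne'
  push_cast
  -- The factor `m + 1` from differentiation is absorbed by `Γ(m + 2) = (m + 1) Γ(m + 1)`, which
  -- turns order `β` of the derivative into order `β + 1` of the function.
  rw [Real.Gamma_add_one hm, show (m : ℝ) + 1 + (β + 1) = m + 1 + 1 + β by ring,
    show (m : ℂ) + 1 + ((β : ℂ) + 1) = m + 1 + 1 + β by ring]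
  push_cast
  field_simp

theorem hasDerivAt_rayHiggins (σ : ℝ) (n : ℕ) (x : ℝ) :
    HasDerivAt (rayHiggins σ n) (rayHigginsDeriv σ n x) x := by
  refine HasDerivAt.const_add 1 (HasDerivAt.fun_sum fun m _ => ?_)
  refine ((hasDerivAt_rayBase_cpow σ x (m + 1)).const_mul (higginsCoeff n m)).congr_deriv ?_
  push_cast
  ring

theorem hasDerivAt_rayHigginsFrac {β : ℝ} (σ : ℝ) (n : ℕ) (h0 : 0 < β) (x : ℝ) :
    HasDerivAt (rayHigginsFrac σ n β) (-(Complex.I * σ) * rayHigginsFrac σ n (β + 1) x) x := by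
  rw [rayHigginsFrac, Finset.mul_sum]
  refine HasDerivAt.fun_sum fun m _ => ?_
  refine (((hasDerivAt_rayBase_cpow σ x (m + 1 + β)).const_mul _).const_mul _).congr_deriv ?_
  have hm : ((m : ℝ) + 1 + β) ≠ 0 := by positivity
  rw [← add_assoc, Real.Gamma_add_one hm]
  push_cast
  rw [← add_assoc]
  ring

/-! ### Bounds -/

theorem rayBase_cpow_neg_succ (σ x : ℝ) (m : ℕ) :
    rayBase σ x ^ (-(m + 1 : ℂ)) = (rayBase σ x ^ (m + 1))⁻¹ := by
  rw [Complex.cpow_neg, ← Complex.cpow_natCast]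
  push_cast
  rfl

theorem norm_rayBase_cpow_le (σ x : ℝ) (m : ℕ) : ‖rayBase σ x ^ (-(m + 1 : ℂ))‖ ≤ 1 := by
  rw [rayBase_cpow_neg_succ, norm_inv, norm_pow]
  exact inv_le_one_of_one_le₀ (one_le_pow₀ (one_le_norm_rayBase σ x))

theorem exists_norm_rayHiggins_le (σ : ℝ) (n : ℕ) : ∃ C, ∀ x, ‖rayHiggins σ n x‖ ≤ C := by
  refine ⟨‖(1 : ℂ)‖ + ∑ m ∈ Finset.range n, ‖higginsCoeff n m‖ * 1, fun x => ?_⟩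
  refine (norm_add_le _ _).trans (add_le_add le_rfl ((norm_sum_le _ _).trans
    (Finset.sum_le_sum fun m _ => ?_)))
  rw [norm_mul]
  gcongr
  exact norm_rayBase_cpow_le σ x m

/-- The second derivative is bounded, because `|w| ≥ 1` bounds every negative power of `w` by `1`.
-/
theorem exists_lipschitz_rayHigginsDeriv (σ : ℝ) (n : ℕ) :
    ∃ C, ∀ x y, ‖rayHigginsDeriv σ n y - rayHigginsDeriv σ n x‖ ≤ C * |y - x| := by
  set C : ℝ := ∑ m ∈ Finset.range n, ‖-(Complex.I * σ) * higginsCoeff n m * (m + 1)‖ *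
    (‖-(Complex.I * (σ : ℂ))‖ * (‖((m + 1 : ℕ) + 1 : ℂ)‖ * 1)) with hC
  have hd : ∀ x, HasDerivAt (rayHigginsDeriv σ n) (∑ m ∈ Finset.range n,
      -(Complex.I * σ) * higginsCoeff n m * (m + 1) * (-(Complex.I * σ) *
        (((m + 1 : ℕ) + 1 : ℂ) * rayBase σ x ^ (-((m + 1 : ℕ) + 1 + 1 : ℂ))))) x := fun x =>
    HasDerivAt.fun_sum fun m _ => (hasDerivAt_rayBase_cpow σ x _).const_mul _
  refine ⟨C, fun x y => ?_⟩
  refine Convex.norm_image_sub_le_of_norm_hasDerivWithin_le (s := univ)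
    (fun x _ => (hd x).hasDerivWithinAt) (fun x _ => ?_) convex_univ (mem_univ x) (mem_univ y)
  refine (norm_sum_le _ _).trans (Finset.sum_le_sum fun m _ => ?_)
  rw [norm_mul, norm_mul (-(Complex.I * (σ : ℂ))) (_ * _), norm_mul ((m + 1 : ℕ) + 1 : ℂ)]
  gcongr
  have := norm_rayBase_cpow_le σ x (m + 1 + 1)
  push_cast at this ⊢
  exact this

/-! ### The Higgins functions and the hypergeometric sum -/

theorem rayHiggins_eq (σ : ℝ) (n : ℕ) (x : ℝ) :
    rayHiggins σ n x = (1 - 2 / rayBase σ x) ^ n := by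
  rw [sub_eq_neg_add, add_pow, Finset.sum_range_succ', rayHiggins, add_comm]
  simp only [one_pow, mul_one, pow_zero, Nat.choose_zero_right, Nat.cast_one]
  congr 1
  refine Finset.sum_congr rfl fun m _ => ?_
  rw [rayBase_cpow_neg_succ, higginsCoeff, neg_div', div_pow]
  ring

theorem higginsBase_eq (k : ℤ) (x : ℝ) : higginsBase k x = rayBase (Int.sign k) x := by
  simp [higginsBase, rayBase]

/-- `(ix - 1)/(ix + 1) = 1 - 2/(ix + 1)`, and its inverse is `1 - 2/(1 - ix)`. Using `σ = sgn k`
thus makes the exponent the natural number `|k|`. -/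
theorem higgins_eq (k : ℤ) : higgins k = rayHiggins (Int.sign k) k.natAbs := by
  funext x
  rw [rayHiggins_eq]
  have hp : Complex.I * (x : ℂ) + 1 ≠ 0 := by
    simpa [rayBase] using rayBase_ne_zero 1 x
  have hm : -(Complex.I * (x : ℂ)) + 1 ≠ 0 := by
    simpa [rayBase] using rayBase_ne_zero (-1) x
  rcases lt_trichotomy k 0 with h | rfl | h
  · obtain ⟨n, rfl⟩ := Int.exists_eq_neg_ofNat h.le
    have hs : Int.sign (-(n : ℤ)) = -1 := Int.sign_eq_neg_one_of_neg h
    have hm' : Complex.I * (x : ℂ) - 1 ≠ 0 := fun h => hm (by linear_combination -h)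
    rw [higgins, zpow_neg, zpow_natCast, ← inv_pow, hs, Int.natAbs_neg, Int.natAbs_natCast]
    congr 1
    simp only [rayBase]
    push_cast
    rw [inv_div, mul_neg_one, neg_mul, eq_sub_iff_add_eq, div_add_div _ _ hm' hm,
      div_eq_one_iff_eq (mul_ne_zero hm' hm)]
    ring
  · simp [higgins]
  · obtain ⟨n, rfl⟩ := Int.eq_ofNat_of_zero_le h.le
    rw [higgins, zpow_natCast, Int.sign_eq_one_of_pos h, Int.natAbs_natCast]
    congr 1
    simp only [rayBase]
    push_cast
    rw [mul_one]
    field_simp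
    ring

/-- Converts the numerator Pochhammer symbol of the terminating series into the binomial
coefficients of `(1 - 2/w) ^ (N + 1)`; both sides vanish for `j > N`. -/
theorem succ_mul_ascPochhammer_neg (N j : ℕ) :
    ((N : ℂ) + 1) * (ascPochhammer ℂ j).eval (-(N : ℂ)) =
      (-1) ^ j * ((N + 1).choose (j + 1) : ℂ) * ((j + 1).factorial : ℂ) := by
  induction j with
  | zero => simp
  | succ j ih =>
    rw [ascPochhammer_succ_eval, ← mul_assoc, ih]
    have h : (((N + 1).choose (j + 1 + 1) : ℂ)) * ((j : ℂ) + 2) =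
        ((N + 1).choose (j + 1) : ℂ) * ((N : ℂ) - j) := by
      have h := Nat.choose_succ_right_eq (N + 1) (j + 1)
      rcases le_or_gt j N with hj | hj
      · rw [Nat.add_sub_add_right] at h
        have h' := congrArg (Nat.cast (R := ℂ)) h
        push_cast [Nat.cast_sub hj] at h'
        linear_combination h'
      · rw [Nat.choose_eq_zero_of_lt (by omega : N + 1 < j + 1 + 1),
          Nat.choose_eq_zero_of_lt (by omega : N + 1 < j + 1)]
        simp
    rw [Nat.factorial_succ (j + 1)]
    push_cast
    linear_combination (-(-1) ^ (j + 1) * ((j + 1).factorial : ℂ)) * h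

theorem ascPochhammer_two (j : ℕ) :
    (ascPochhammer ℂ j).eval 2 = ((j + 1).factorial : ℂ) := by
  induction j with
  | zero => simp
  | succ j ih =>
    rw [ascPochhammer_succ_eval, ih, Nat.factorial_succ (j + 1)]
    push_cast
    ring

theorem Gamma_mul_ascPochhammer {α : ℝ} (hα : 0 < α) (j : ℕ) :
    (Real.Gamma (1 + α) : ℂ) * (ascPochhammer ℂ j).eval (1 + (α : ℂ)) =
      Real.Gamma (j + 1 + α) := by
  induction j with
  | zero => simp
  | succ j ih =>
    rw [ascPochhammer_succ_eval, ← mul_assoc, ih]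
    have h : (j : ℝ) + 1 + α ≠ 0 := by positivity
    rw [show ((j + 1 : ℕ) : ℝ) + 1 + α = (j + 1 + α) + 1 by push_cast; ring,
      Real.Gamma_add_one h]
    push_cast
    ring

theorem higginsHypergeometric_eq {α : ℝ} (hα : 0 < α) (k : ℤ) (x : ℝ) :
    higginsHypergeometric α k x = -rayHigginsFrac (Int.sign k) k.natAbs α x := by
  have habs : ((|k| : ℤ) : ℂ) = (k.natAbs : ℂ) := by
    rw [← Int.natCast_natAbs]
    simp
  rw [higginsHypergeometric, higginsBase_eq, habs]
  generalize (Int.sign k : ℝ) = σ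
  rcases k.natAbs with _ | N
  · simp [rayHigginsFrac]
  have hw := rayBase_ne_zero σ x
  set w := rayBase σ x with hwdef
  have ha : (1 : ℂ) - ((N + 1 : ℕ) : ℂ) = -(N : ℂ) := by push_cast; ring
  rw [ha, ordinaryHypergeometric_eq_tsum]
  beta_reduce
  rw [tsum_eq_sum (s := Finset.range (N + 1)), rayHigginsFrac, Finset.mul_sum,
    ← Finset.sum_neg_distrib]
  · refine Finset.sum_congr rfl fun j _ => ?_
    have h1 := succ_mul_ascPochhammer_neg N j
    have h2 := Gamma_mul_ascPochhammer hα j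
    have hj : ((j.factorial : ℂ)) ≠ 0 := by exact_mod_cast j.factorial_ne_zero
    have hj1 : (((j + 1).factorial : ℂ)) ≠ 0 := by exact_mod_cast (j + 1).factorial_ne_zero
    have hpow : w ^ (-(j + 1 + α : ℂ)) = (w ^ (1 + (α : ℂ)))⁻¹ * (w ^ j)⁻¹ := by
      rw [Complex.cpow_neg, show (j + 1 + α : ℂ) = (1 + α) + j by ring, Complex.cpow_add _ _ hw,
        Complex.cpow_natCast, mul_inv]
    rw [← hwdef, hpow, ascPochhammer_two, Real.Gamma_nat_eq_factorial, smul_eq_mul, div_pow,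
      higginsCoeff, ← h2]
    have hP : (w ^ (1 + (α : ℂ))) ≠ 0 := by simp [Complex.cpow_eq_zero_iff, hw]
    generalize w ^ (1 + (α : ℂ)) = P at hP ⊢
    push_cast at h1 ⊢
    rw [eq_comm, ← sub_eq_zero]
    field_simp
    rw [pow_succ, neg_pow (2 : ℂ) j]
    linear_combination
      (-2 * 2 ^ j * (Real.Gamma (1 + α) : ℂ) * (Polynomial.eval (1 + (α : ℂ)) (ascPochhammer ℂ j))) * h1
  · intro j hj
    rw [Finset.mem_range, not_lt] at hj
    rw [ascPochhammer_eval_neg_coe_nat_of_lt (by omega)]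
    simp

/-! ### The constant of the fractional Laplacian -/

/-- Legendre duplication at `(1 - α)/2` and the reflection formula at `1/2 + α/2` share the factor
`Γ((1 - α)/2)`; eliminating it gives the identity. At `α = 1` the cosine vanishes. -/
theorem fracLaplacianConst_mul {α : ℝ} (h0 : 0 < α) (h2 : α < 2) (h1 : α ≠ 1) :
    fracLaplacianConst α * (2 * Real.Gamma (-α) * Real.cos (α * (Real.pi / 2))) = -1 := by
  have hdup := Real.Gamma_mul_Gamma_add_half ((1 - α) / 2)
  have hrefl := Real.Gamma_mul_Gamma_one_sub (1 / 2 + α / 2)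
  rw [show (1 - α) / 2 + 1 / 2 = 1 - α / 2 by ring, show 2 * ((1 - α) / 2) = 1 - α by ring,
    show 1 - (1 - α) = α by ring, Gamma_neg_eq h0] at hdup
  rw [show 1 - (1 / 2 + α / 2) = (1 - α) / 2 by ring,
    show Real.pi * (1 / 2 + α / 2) = α * (Real.pi / 2) + Real.pi / 2 by ring,
    Real.sin_add_pi_div_two] at hrefl
  have hc : Real.cos (α * (Real.pi / 2)) ≠ 0 := by
    intro hc
    rcases lt_or_gt_of_ne h1 with h | h
    · exact (Real.cos_pos_of_mem_Ioo ⟨by nlinarith [Real.pi_pos], by nlinarith [Real.pi_pos]⟩).ne' hc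
    · exact (Real.cos_neg_of_pi_div_two_lt_of_lt (by nlinarith [Real.pi_pos])
        (by nlinarith [Real.pi_pos])).ne hc
  have hG : Real.Gamma (1 - α / 2) ≠ 0 := (Real.Gamma_pos_of_pos (by linarith)).ne'
  have hs : Real.sqrt Real.pi ≠ 0 := (Real.sqrt_pos.mpr Real.pi_pos).ne'
  have hss : Real.sqrt Real.pi * Real.sqrt Real.pi = Real.pi := Real.mul_self_sqrt Real.pi_pos.le
  have hpow : (2 : ℝ) ^ (α - 1) * 2 = 2 ^ α := by
    rw [← Real.rpow_add_one two_ne_zero]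
    ring_nf
  rw [eq_div_iff hc] at hrefl
  rw [fracLaplacianConst, div_mul_eq_mul_div, div_eq_iff (mul_ne_zero hs hG)]
  rw [← mul_right_inj' hs]
  rw [← hpow] at hdup
  linear_combination (Real.Gamma (1 / 2 + α / 2) * Real.cos (α * (Real.pi / 2))) * hdup -
    Real.Gamma (1 - α / 2) * (hrefl - hss)

/-! ### Principal values by symmetrization -/

theorem setOf_lt_abs_eq (ε : ℝ) : {y : ℝ | ε < |y|} = Iio (-ε) ∪ Ioi ε := by
  ext y
  simp only [mem_ofPred_eq, lt_abs, mem_union, mem_Iio, mem_Ioi, lt_neg, or_comm]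

theorem truncatedIntegral_eq {f : ℝ → ℂ} {ε : ℝ} (hε : 0 < ε)
    (hf : IntegrableOn f {y : ℝ | ε < |y|}) :
    truncatedIntegral f ε = ∫ y in Ioi ε, (f y + f (-y)) := by
  rw [truncatedIntegral]
  rw [setOf_lt_abs_eq] at hf ⊢
  have h1 := hf.left_of_union
  have h2 := hf.right_of_union
  have h3 : IntegrableOn (fun y => f (-y)) (Ioi ε) := by simpa using h1.comp_neg
  rw [setIntegral_union (by
      rw [disjoint_left]
      intro y (hy : y < -ε) (hy' : ε < y)
      linarith) measurableSet_Ioi h1 h2, integral_add h2 h3,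
    integral_comp_neg_Ioi, integral_Iic_eq_integral_Iio, add_comm]

theorem tendsto_truncatedIntegral {f : ℝ → ℂ}
    (hf : ∀ ε : ℝ, 0 < ε → IntegrableOn f {y : ℝ | ε < |y|})
    (hg : IntegrableOn (fun y => f y + f (-y)) (Ioi 0)) :
    Tendsto (truncatedIntegral f) (𝓝[>] 0) (𝓝 (∫ y in Ioi (0 : ℝ), (f y + f (-y)))) := by
  have hcov : AECover (volume.restrict (Ioi (0 : ℝ))) (𝓝[>] (0 : ℝ)) fun ε : ℝ => Ioi ε :=
    aecover_Ioi_of_Ioi (tendsto_id.mono_left nhdsWithin_le_nhds)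
  refine (hcov.integral_tendsto_of_countably_generated hg).congr' ?_
  filter_upwards [self_mem_nhdsWithin] with ε (hε : 0 < ε)
  rw [truncatedIntegral_eq hε (hf ε hε), Measure.restrict_restrict measurableSet_Ioi,
    inter_eq_left.mpr (Ioi_subset_Ioi hε.le)]

theorem hasPrincipalValue_of_symm {f : ℝ → ℂ}
    (hf : ∀ ε : ℝ, 0 < ε → IntegrableOn f {y : ℝ | ε < |y|})
    (hg : IntegrableOn (fun y => f y + f (-y)) (Ioi 0)) :
    HasPrincipalValue f ∧ principalValue f = ∫ y in Ioi (0 : ℝ), (f y + f (-y)) :=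
  have h := tendsto_truncatedIntegral hf hg
  ⟨⟨hf, _, h⟩, h.limUnder_eq⟩

theorem integrableOn_fracLaplacianIntegrand {α C : ℝ} {u : ℝ → ℂ} (hα : 0 < α)
    (hu : Continuous u) (hC : ∀ x, ‖u x‖ ≤ C) (x : ℝ) {ε : ℝ} (hε : 0 < ε) :
    IntegrableOn (fracLaplacianIntegrand α u x) {y : ℝ | ε < |y|} := by
  have hr : IntegrableOn (fun y : ℝ => 2 * C * |y| ^ (-(1 + α))) (Ioi ε) :=
    (IntegrableOn.congr_fun (integrableOn_Ioi_rpow_of_lt (by linarith : -(1 + α) < -1) hε)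
      (fun y (hy : ε < y) => by simp only [abs_of_pos (hε.trans hy)]) measurableSet_Ioi).const_mul _
  have hl : IntegrableOn (fun y : ℝ => 2 * C * |y| ^ (-(1 + α))) (Iio (-ε)) := by
    simpa using hr.comp_neg
  have hb : IntegrableOn (fun y : ℝ => 2 * C * |y| ^ (-(1 + α))) {y : ℝ | ε < |y|} := by
    rw [setOf_lt_abs_eq]
    exact hl.union hr
  refine hb.mono' ?_ (.of_forall fun y => ?_)
  · have := hu.measurable
    unfold fracLaplacianIntegrand
    exact Measurable.aestronglyMeasurable (by fun_prop)
  · rw [fracLaplacianIntegrand, norm_div, Complex.norm_real,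
      Real.norm_of_nonneg (Real.rpow_nonneg (abs_nonneg y) _), Real.rpow_neg (abs_nonneg y),
      ← div_eq_mul_inv]
    gcongr
    linarith [norm_sub_le (u x) (u (x + y)), hC x, hC (x + y)]

theorem fracLaplacianIntegrand_symm {α : ℝ} (u : ℝ → ℂ) (x : ℝ) {y : ℝ} (hy : 0 < y) :
    fracLaplacianIntegrand α u x y + fracLaplacianIntegrand α u x (-y) =
      (2 * u x - u (x + y) - u (x - y)) / ((y ^ (1 + α) : ℝ) : ℂ) := by
  rw [fracLaplacianIntegrand, fracLaplacianIntegrand, abs_neg, abs_of_pos hy, ← add_div,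
    ← sub_eq_add_neg]
  ring

theorem hasPrincipalValue_fracLaplacianIntegrand {α C : ℝ} {u : ℝ → ℂ} (hα : 0 < α)
    (hu : Continuous u) (hC : ∀ x, ‖u x‖ ≤ C) (x : ℝ)
    (hg : IntegrableOn (fun y : ℝ => (2 * u x - u (x + y) - u (x - y)) /
      ((y ^ (1 + α) : ℝ) : ℂ)) (Ioi 0)) :
    FracLaplacianConverges α u x ∧ principalValue (fracLaplacianIntegrand α u x) =
      ∫ y in Ioi (0 : ℝ), (2 * u x - u (x + y) - u (x - y)) / ((y ^ (1 + α) : ℝ) : ℂ) := by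
  have he : ∀ y ∈ Ioi (0 : ℝ), _ := fun y hy => fracLaplacianIntegrand_symm (α := α) u x hy
  have h := hasPrincipalValue_of_symm
    (fun ε hε => integrableOn_fracLaplacianIntegrand hα hu hC x hε)
    (hg.congr_fun (fun y hy => (he y hy).symm) measurableSet_Ioi)
  rwa [setIntegral_congr_fun measurableSet_Ioi he] at h

/-! ### Second differences -/

theorem hasDerivAt_second_difference {u u' : ℝ → ℂ} (hu : ∀ x, HasDerivAt u (u' x) x) (x z : ℝ) :
    HasDerivAt (fun y => 2 * u x - u (x + y) - u (x - y)) (u' (x - z) - u' (x + z)) z := by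
  have h1 := (hu (x + z)).comp_const_add x z
  have h2 := (hu (x - z)).comp_const_sub x z
  exact ((h1.const_sub (2 * u x)).sub h2).congr_deriv (by ring)

/-- The derivative in the step `z` is `u'(x - z) - u'(x + z)`, of size at most `2Cz ≤ 2Cy`; the mean
value inequality on `[0, y]` gives the second factor `y`. -/
theorem norm_second_difference_le {u u' : ℝ → ℂ} (hu : ∀ x, HasDerivAt u (u' x) x) {C : ℝ}
    (hC : ∀ x y, ‖u' y - u' x‖ ≤ C * |y - x|) (x : ℝ) {y : ℝ} (hy : 0 ≤ y) :
    ‖2 * u x - u (x + y) - u (x - y)‖ ≤ 2 * C * y ^ 2 := by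
  have hC0 : 0 ≤ C := by simpa using (norm_nonneg _).trans (hC 0 1)
  have h := Convex.norm_image_sub_le_of_norm_hasDerivWithin_le (s := Icc 0 y) (x := 0) (y := y)
    (C := 2 * C * y) (fun z _ => (hasDerivAt_second_difference hu x z).hasDerivWithinAt) (fun z hz => ?_) (convex_Icc 0 y)
    (left_mem_Icc.mpr hy) (right_mem_Icc.mpr hy)
  · simp only [add_zero, sub_zero, Real.norm_of_nonneg hy] at h
    convert! h using 1
    · congr 1
      ring
    · ring
  · refine (hC _ _).trans ?_
    rw [show x - z - (x + z) = -(2 * z) by ring, abs_neg, abs_of_nonneg (by linarith [hz.1])]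
    nlinarith [hz.2]

theorem exists_norm_second_difference_le {u u' : ℝ → ℂ} (hu : ∀ x, HasDerivAt u (u' x) x)
    {C C' : ℝ} (hC : ∀ x, ‖u x‖ ≤ C) (hC' : ∀ x y, ‖u' y - u' x‖ ≤ C' * |y - x|) :
    ∃ K, 0 ≤ K ∧ ∀ x y, 0 ≤ y → ‖2 * u x - u (x + y) - u (x - y)‖ ≤ K * min 1 (y ^ 2) := by
  have hC'0 : 0 ≤ C' := by simpa using (norm_nonneg _).trans (hC' 0 1)
  have hC0 : 0 ≤ C := (norm_nonneg _).trans (hC 0)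
  refine ⟨4 * C + 2 * C', by positivity, fun x y hy => ?_⟩
  have h1 : ‖2 * u x - u (x + y) - u (x - y)‖ ≤ 4 * C := by
    have h2 : ‖2 * u x‖ ≤ 2 * C := by
      rw [norm_mul]
      simpa using hC x
    linarith [norm_sub_le (2 * u x - u (x + y)) (u (x - y)), norm_sub_le (2 * u x) (u (x + y)),
      hC (x + y), hC (x - y)]
  have h2 := norm_second_difference_le hu hC' x hy
  rw [mul_min_of_nonneg _ _ (by positivity)]
  refine le_min (by linarith) (h2.trans ?_)
  gcongr
  linarith

theorem integrableOn_second_difference_div {u u' : ℝ → ℂ} (hu : ∀ x, HasDerivAt u (u' x) x)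
    {α C C' : ℝ} (h0 : 0 < α) (h2 : α < 2) (hC : ∀ x, ‖u x‖ ≤ C)
    (hC' : ∀ x y, ‖u' y - u' x‖ ≤ C' * |y - x|) (x : ℝ) :
    IntegrableOn (fun y : ℝ => (2 * u x - u (x + y) - u (x - y)) / ((y ^ (1 + α) : ℝ) : ℂ))
      (Ioi 0) := by
  obtain ⟨K, hK0, hK⟩ := exists_norm_second_difference_le hu hC hC'
  have hc : Continuous u := continuous_iff_continuousAt.mpr fun x => (hu x).continuousAt
  have := hc.measurable
  refine ((integrableOn_min_one_rpow_div_rpow h0 h2).const_mul K).mono'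
    (Measurable.aestronglyMeasurable (by fun_prop)) ?_
  filter_upwards [ae_restrict_mem measurableSet_Ioi] with y (hy : 0 < y)
  rw [norm_div, Complex.norm_real, Real.norm_of_nonneg (Real.rpow_nonneg hy.le _), ← mul_div_assoc,
    Real.rpow_two]
  gcongr
  exact hK x y hy.le

/-- Integration by parts against `-y ^ (-α) / α`. The boundary term at `0` vanishes because the
second difference is `O(y ^ 2)` and `α < 2`, the one at infinity because it is bounded. -/
theorem integral_second_difference_div {u u' : ℝ → ℂ} (hu : ∀ x, HasDerivAt u (u' x) x)
    {α C C' : ℝ} (h0 : 0 < α) (h2 : α < 2) (hC : ∀ x, ‖u x‖ ≤ C)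
    (hC' : ∀ x y, ‖u' y - u' x‖ ≤ C' * |y - x|) (x : ℝ)
    (hi : IntegrableOn (fun y : ℝ => (u' (x - y) - u' (x + y)) / ((y ^ α : ℝ) : ℂ)) (Ioi 0)) :
    ∫ y in Ioi (0 : ℝ), (2 * u x - u (x + y) - u (x - y)) / ((y ^ (1 + α) : ℝ) : ℂ) =
      (α : ℂ)⁻¹ * ∫ y in Ioi (0 : ℝ), (u' (x - y) - u' (x + y)) / ((y ^ α : ℝ) : ℂ) := by
  obtain ⟨K, hK0, hK⟩ := exists_norm_second_difference_le hu hC hC'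
  have hα : (α : ℂ) ≠ 0 := by exact_mod_cast h0.ne'
  have hcongr : ∀ y ∈ Ioi (0 : ℝ), (u' (x - y) - u' (x + y)) *
      (-(α : ℂ)⁻¹ * ((y ^ (-α) : ℝ) : ℂ)) =
      -(α : ℂ)⁻¹ * ((u' (x - y) - u' (x + y)) / ((y ^ α : ℝ) : ℂ)) := by
    intro y (hy : 0 < y)
    rw [Real.rpow_neg hy.le]
    push_cast
    ring
  have hnorm : ∀ y : ℝ, 0 < y → ‖(2 * u x - u (x + y) - u (x - y)) *
      (-(α : ℂ)⁻¹ * ((y ^ (-α) : ℝ) : ℂ))‖ ≤ K * min 1 (y ^ 2) * (α⁻¹ * y ^ (-α)) := by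
    intro y hy
    simp only [norm_mul, norm_neg, norm_inv, Complex.norm_real, Real.norm_of_nonneg h0.le,
      Real.norm_of_nonneg (Real.rpow_nonneg hy.le (-α))]
    gcongr
    exact hK x y hy.le
  have key := integral_Ioi_mul_deriv_eq_deriv_mul (a := 0) (a' := 0) (b' := 0)
    (u := fun y : ℝ => 2 * u x - u (x + y) - u (x - y))
    (u' := fun y : ℝ => u' (x - y) - u' (x + y))
    (v := fun y : ℝ => -(α : ℂ)⁻¹ * ((y ^ (-α) : ℝ) : ℂ))
    (v' := fun y : ℝ => 1 / ((y ^ (1 + α) : ℝ) : ℂ))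
    (fun y _ => hasDerivAt_second_difference hu x y) ?_ ?_ ?_ ?_ ?_
  · simp only [mul_one_div] at key
    rw [key, setIntegral_congr_fun measurableSet_Ioi hcongr, integral_const_mul]
    ring
  · intro z (hz : 0 < z)
    refine ((hasDerivAt_ofReal_rpow (-α) hz).const_mul _).congr_deriv ?_
    rw [show -α - 1 = -(1 + α) by ring, Real.rpow_neg hz.le]
    push_cast
    field_simp
  · simpa only [Pi.mul_def, mul_one_div] using
      integrableOn_second_difference_div hu h0 h2 hC hC' x
  · exact IntegrableOn.congr_fun (hi.const_mul _) (fun y hy => (hcongr y hy).symm)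
      measurableSet_Ioi
  · have hlim : Tendsto (fun y : ℝ => K * α⁻¹ * y ^ (2 - α)) (𝓝[>] 0) (𝓝 0) := by
      have : Continuous fun y : ℝ => K * α⁻¹ * y ^ (2 - α) :=
        continuous_const.mul (Real.continuous_rpow_const (by linarith))
      have h := this.tendsto 0
      simp only [Real.zero_rpow (by linarith : 2 - α ≠ 0), mul_zero] at h
      exact h.mono_left nhdsWithin_le_nhds
    refine squeeze_zero_norm' ?_ hlim
    filter_upwards [self_mem_nhdsWithin] with y (hy : 0 < y)
    refine (hnorm y hy).trans ?_
    rw [sub_eq_add_neg, Real.rpow_add hy, Real.rpow_two]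
    calc _ ≤ K * y ^ 2 * (α⁻¹ * y ^ (-α)) := by
          gcongr
          exact min_le_right _ _
      _ = _ := by ring
  · have hlim : Tendsto (fun y : ℝ => K * α⁻¹ * y ^ (-α)) atTop (𝓝 0) := by
      simpa using (tendsto_rpow_neg_atTop h0).const_mul (K * α⁻¹)
    refine squeeze_zero_norm' ?_ hlim
    filter_upwards [eventually_gt_atTop 0] with y (hy : 0 < y)
    refine (hnorm y hy).trans ?_
    calc _ ≤ K * 1 * (α⁻¹ * y ^ (-α)) := by
          gcongr
          exact min_le_left _ _
      _ = _ := by ring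

/-! ### Phases -/

theorem phase_add (a b : ℝ) : phase (a + b) = phase a * phase b := by
  rw [phase, phase, phase, ← Complex.exp_add]
  push_cast
  ring_nf

theorem phase_pi_div_two {σ : ℝ} (hσ : σ = 1 ∨ σ = -1) :
    phase (σ * (Real.pi / 2)) = Complex.I * σ := by
  rcases hσ with rfl | rfl
  · rw [phase, show Complex.I * ((1 * (Real.pi / 2) : ℝ) : ℂ) = Real.pi / 2 * Complex.I by
      push_cast; ring, Complex.exp_pi_div_two_mul_I]
    simp
  · rw [phase, show Complex.I * ((-1 * (Real.pi / 2) : ℝ) : ℂ) = -Real.pi / 2 * Complex.I by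
      push_cast; ring, Complex.exp_neg_pi_div_two_mul_I]
    simp

theorem phase_add_phase_neg {σ : ℝ} (hσ : σ = 1 ∨ σ = -1) (θ : ℝ) :
    phase (σ * θ) + phase (-(σ * θ)) = 2 * Real.cos θ := by
  have h : ∀ t : ℝ, phase t + phase (-t) = 2 * Real.cos t := fun t => by
    rw [phase, phase, Complex.ofReal_cos, Complex.two_cos]
    push_cast
    ring_nf
  rw [h]
  rcases hσ with rfl | rfl <;> simp

/-! ### From half-line integrals to the Weyl–Marchaud derivatives -/

section Marchaud

variable {σ β : ℝ} {u A : ℝ → ℂ}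

theorem marchaudIntegrand_neg_of_pos (β : ℝ) (u : ℝ → ℂ) (x : ℝ) {z : ℝ} (hz : 0 < z) :
    marchaudIntegrand β u x (-z) = (u (x + (-1 : ℝ) * z) - u x) / ((z ^ (1 + β) : ℝ) : ℂ) := by
  rw [marchaudIntegrand, abs_neg, abs_of_pos hz, neg_one_mul]

theorem marchaudIntegrand_of_pos (β : ℝ) (u : ℝ → ℂ) (x : ℝ) {z : ℝ} (hz : 0 < z) :
    marchaudIntegrand β u x z = (u (x + (1 : ℝ) * z) - u x) / ((z ^ (1 + β) : ℝ) : ℂ) := by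
  rw [marchaudIntegrand, abs_of_pos hz, one_mul]

theorem Gamma_neg_ne_zero (h0 : 0 < β) (h1 : β < 1) : (Real.Gamma (-β) : ℂ) ≠ 0 := by
  have h := Gamma_neg_eq h0
  have h' : Real.Gamma (1 - β) ≠ 0 := (Real.Gamma_pos_of_pos (by linarith)).ne'
  intro hz
  rw [Complex.ofReal_eq_zero] at hz
  simp [h, hz] at h'

theorem HasMarchaudIntegrals.weylMarchaudConverges (h : HasMarchaudIntegrals σ β u A) (x : ℝ) :
    WeylMarchaudConverges β u x := by
  have h1 : IntegrableOn (fun z => marchaudIntegrand β u x (-z)) (Ioi 0) :=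
    IntegrableOn.congr_fun (h (-1) (Or.inr rfl) x).1
      (fun z hz => (marchaudIntegrand_neg_of_pos β u x hz).symm) measurableSet_Ioi
  simpa [WeylMarchaudConverges] using h1.comp_neg

theorem HasMarchaudIntegrals.weylMarchaudBarConverges (h : HasMarchaudIntegrals σ β u A) (x : ℝ) :
    WeylMarchaudBarConverges β u x :=
  IntegrableOn.congr_fun (h 1 (Or.inl rfl) x).1
    (fun _ hz => (marchaudIntegrand_of_pos β u x hz).symm) measurableSet_Ioi

theorem HasMarchaudIntegrals.weylMarchaud_eq (h : HasMarchaudIntegrals σ β u A) (h0 : 0 < β)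
    (h1 : β < 1) (x : ℝ) : weylMarchaud β u x = phase (-σ * β * (Real.pi / 2)) * A x := by
  have hi : ∫ z in Iio (0 : ℝ), marchaudIntegrand β u x z =
      ∫ z in Ioi (0 : ℝ), marchaudIntegrand β u x (-z) := by
    rw [integral_comp_neg_Ioi, neg_zero, integral_Iic_eq_integral_Iio]
  rw [weylMarchaud, hi, setIntegral_congr_fun measurableSet_Ioi
    (fun z hz => marchaudIntegrand_neg_of_pos β u x hz), (h (-1) (Or.inr rfl) x).2, mul_neg_one]
  have := Gamma_neg_ne_zero h0 h1
  field_simp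

theorem HasMarchaudIntegrals.weylMarchaudBar_eq (h : HasMarchaudIntegrals σ β u A) (h0 : 0 < β)
    (h1 : β < 1) (x : ℝ) : weylMarchaudBar β u x = -(phase (σ * β * (Real.pi / 2)) * A x) := by
  rw [weylMarchaudBar, setIntegral_congr_fun measurableSet_Ioi
    (fun z hz => marchaudIntegrand_of_pos β u x hz), (h 1 (Or.inl rfl) x).2, mul_one]
  have := Gamma_neg_ne_zero h0 h1
  field_simp

end Marchaud

/-! ### The fractional Laplacian of the Higgins functions -/

section Laplacian

variable {σ α : ℝ} {n : ℕ}

theorem rayHigginsFrac_zero (σ α x : ℝ) : rayHigginsFrac σ 0 α x = 0 := by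
  simp [rayHigginsFrac]

theorem continuous_rayHiggins (σ : ℝ) (n : ℕ) : Continuous (rayHiggins σ n) :=
  continuous_iff_continuousAt.mpr fun x => (hasDerivAt_rayHiggins σ n x).continuousAt

/-- The second difference is minus the sum of the forward and backward first differences, each
integrable on its own when `α < 1`; their conjugate phases add up to `2 cos(απ/2)`. -/
theorem integral_second_difference_rayHiggins_of_lt_one (hσ : n ≠ 0 → σ = 1 ∨ σ = -1)
    (h0 : 0 < α) (h1 : α < 1) (x : ℝ) :
    ∫ y in Ioi (0 : ℝ), (2 * rayHiggins σ n x - rayHiggins σ n (x + y) - rayHiggins σ n (x - y)) /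
      ((y ^ (1 + α) : ℝ) : ℂ) =
    -(2 * Real.Gamma (-α) * Real.cos (α * (Real.pi / 2))) * rayHigginsFrac σ n α x := by
  have h := hasMarchaudIntegrals_rayHiggins hσ h0 h1
  obtain ⟨ip, vp⟩ := h 1 (Or.inl rfl) x
  obtain ⟨im, vm⟩ := h (-1) (Or.inr rfl) x
  have e : (fun y : ℝ => (2 * rayHiggins σ n x - rayHiggins σ n (x + y) - rayHiggins σ n (x - y)) /
      ((y ^ (1 + α) : ℝ) : ℂ)) = fun y : ℝ =>
      -((rayHiggins σ n (x + 1 * y) - rayHiggins σ n x) / ((y ^ (1 + α) : ℝ) : ℂ) +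
        (rayHiggins σ n (x + -1 * y) - rayHiggins σ n x) / ((y ^ (1 + α) : ℝ) : ℂ)) := by
    funext y
    rw [one_mul, neg_one_mul, ← sub_eq_add_neg]
    ring
  rw [e, integral_neg, integral_add ip im, vp, vm]
  rcases eq_or_ne n 0 with rfl | hn
  · simp [rayHigginsFrac_zero]
  have hp := phase_add_phase_neg (hσ hn) (α * (Real.pi / 2))
  rw [show σ * 1 * α * (Real.pi / 2) = σ * (α * (Real.pi / 2)) by ring,
    show σ * -1 * α * (Real.pi / 2) = -(σ * (α * (Real.pi / 2))) by ring]
  linear_combination (-Real.Gamma (-α) * rayHigginsFrac σ n α x) * hp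

/-- Passing from `α` to `α - 1` turns the two phases by `∓iσ`. With the factor `-iσ` of the
derivative this gives `-1` forward and `+1` backward, so the difference of the integrals again
yields the sum of the phases. -/
theorem second_difference_deriv_rayHiggins (hσ : n ≠ 0 → σ = 1 ∨ σ = -1)
    (h1 : 1 < α) (h2 : α < 2) (x : ℝ) :
    IntegrableOn (fun y : ℝ => (rayHigginsDeriv σ n (x - y) - rayHigginsDeriv σ n (x + y)) /
      ((y ^ α : ℝ) : ℂ)) (Ioi 0) ∧
    ∫ y in Ioi (0 : ℝ), (rayHigginsDeriv σ n (x - y) - rayHigginsDeriv σ n (x + y)) /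
      ((y ^ α : ℝ) : ℂ) =
    2 * Real.Gamma (1 - α) * Real.cos (α * (Real.pi / 2)) * rayHigginsFrac σ n α x := by
  have h := hasMarchaudIntegrals_rayHigginsDeriv (β := α - 1) hσ (by linarith) (by linarith)
  obtain ⟨ip, vp⟩ := h 1 (Or.inl rfl) x
  obtain ⟨im, vm⟩ := h (-1) (Or.inr rfl) x
  rw [show 1 + (α - 1) = α by ring] at ip im vp vm
  rw [sub_add_cancel] at vp vm
  have e : (fun y : ℝ => (rayHigginsDeriv σ n (x - y) - rayHigginsDeriv σ n (x + y)) /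
      ((y ^ α : ℝ) : ℂ)) = fun y : ℝ =>
      (rayHigginsDeriv σ n (x + -1 * y) - rayHigginsDeriv σ n x) / ((y ^ α : ℝ) : ℂ) -
        (rayHigginsDeriv σ n (x + 1 * y) - rayHigginsDeriv σ n x) / ((y ^ α : ℝ) : ℂ) := by
    funext y
    rw [one_mul, neg_one_mul, ← sub_eq_add_neg]
    ring
  rw [e]
  refine ⟨im.sub ip, ?_⟩
  rw [integral_sub im ip, vp, vm]
  rcases eq_or_ne n 0 with rfl | hn
  · simp [rayHigginsFrac_zero]
  have hp := phase_add_phase_neg (hσ hn) (α * (Real.pi / 2))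
  have hq := phase_pi_div_two (hσ hn)
  have hσ' : -σ = 1 ∨ -σ = -1 := by rcases hσ hn with h | h <;> simp [h]
  have hq' := phase_pi_div_two hσ'
  have hsq : (σ : ℂ) ^ 2 = 1 := by rcases hσ hn with rfl | rfl <;> simp
  rw [show σ * 1 * (α - 1) * (Real.pi / 2) = σ * (α * (Real.pi / 2)) + -σ * (Real.pi / 2) by ring,
    show σ * -1 * (α - 1) * (Real.pi / 2) = -(σ * (α * (Real.pi / 2))) + σ * (Real.pi / 2) by ring,
    phase_add, phase_add, hq, hq', neg_sub]
  push_cast at hp ⊢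
  linear_combination (Real.Gamma (1 - α) * rayHigginsFrac σ n α x) * hp -
    (Real.Gamma (1 - α) * rayHigginsFrac σ n α x) * (phase (σ * (α * (Real.pi / 2))) +
      phase (-(σ * (α * (Real.pi / 2))))) * (σ ^ 2 * Complex.I_sq - hsq)

theorem fracLaplacian_rayHiggins (hσ : n ≠ 0 → σ = 1 ∨ σ = -1) (h0 : 0 < α) (h2 : α < 2)
    (h1 : α ≠ 1) (x : ℝ) :
    FracLaplacianConverges α (rayHiggins σ n) x ∧
      fracLaplacian α (rayHiggins σ n) x = rayHigginsFrac σ n α x := by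
  obtain ⟨C, hC⟩ := exists_norm_rayHiggins_le σ n
  obtain ⟨C', hC'⟩ := exists_lipschitz_rayHigginsDeriv σ n
  have hd := hasDerivAt_rayHiggins σ n
  obtain ⟨hconv, hval⟩ := hasPrincipalValue_fracLaplacianIntegrand h0 (continuous_rayHiggins σ n)
    hC x (integrableOn_second_difference_div hd h0 h2 hC hC' x)
  refine ⟨hconv, ?_⟩
  have hint : ∫ y in Ioi (0 : ℝ),
      (2 * rayHiggins σ n x - rayHiggins σ n (x + y) - rayHiggins σ n (x - y)) /
        ((y ^ (1 + α) : ℝ) : ℂ) =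
      -(2 * Real.Gamma (-α) * Real.cos (α * (Real.pi / 2))) * rayHigginsFrac σ n α x := by
    rcases lt_or_gt_of_ne h1 with h | h
    · exact integral_second_difference_rayHiggins_of_lt_one hσ h0 h x
    · obtain ⟨hi, hv⟩ := second_difference_deriv_rayHiggins hσ h h2 x
      -- `Γ(1 - α) = -α Γ(-α)` cancels the `1/α` from the integration by parts, so both ranges of
      -- `α` give one formula.
      rw [integral_second_difference_div hd h0 h2 hC hC' x hi, hv, Gamma_neg_eq h0]
      have hα : (α : ℂ) ≠ 0 := by exact_mod_cast h0.ne'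
      push_cast
      field_simp
  have hc : (fracLaplacianConst α : ℂ) *
      (2 * Real.Gamma (-α) * Real.cos (α * (Real.pi / 2))) = -1 := by
    exact_mod_cast fracLaplacianConst_mul h0 h2 h1
  rw [fracLaplacian, hval, hint]
  linear_combination (-rayHigginsFrac σ n α x) * hc

end Laplacian

/-! ### Derivatives of the Weyl–Marchaud derivatives, for `1 < α < 2` -/

section Derivatives

variable {σ α : ℝ} {n : ℕ}

/-- The closed form of order `α - 1` is differentiated term by term; its extra phase `iσ` cancels
the factor `-iσ`. -/
theorem hasDerivAt_weylMarchaud_rayHiggins (hσ : n ≠ 0 → σ = 1 ∨ σ = -1) (h1 : 1 < α)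
    (h2 : α < 2) (x : ℝ) :
    HasDerivAt (weylMarchaud (α - 1) (rayHiggins σ n))
      (phase (-σ * α * (Real.pi / 2)) * rayHigginsFrac σ n α x) x := by
  have hβ0 : 0 < α - 1 := by linarith
  have hβ1 : α - 1 < 1 := by linarith
  rw [funext ((hasMarchaudIntegrals_rayHiggins hσ hβ0 hβ1).weylMarchaud_eq hβ0 hβ1)]
  refine ((hasDerivAt_rayHigginsFrac σ n hβ0 x).const_mul _).congr_deriv ?_
  rw [sub_add_cancel]
  rcases eq_or_ne n 0 with rfl | hn
  · simp [rayHigginsFrac_zero]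
  have hsq : (σ : ℂ) ^ 2 = 1 := by rcases hσ hn with rfl | rfl <;> simp
  rw [show -σ * (α - 1) * (Real.pi / 2) = -σ * α * (Real.pi / 2) + σ * (Real.pi / 2) by ring,
    phase_add, phase_pi_div_two (hσ hn)]
  linear_combination (-phase (-σ * α * (Real.pi / 2)) * rayHigginsFrac σ n α x) *
    (σ ^ 2 * Complex.I_sq - hsq)

/-- Here the extra phase is `-iσ`, and `(-iσ)² = -1` cancels the leading minus sign. Hence the sign
differs from the case `α < 1`. -/
theorem hasDerivAt_weylMarchaudBar_rayHiggins (hσ : n ≠ 0 → σ = 1 ∨ σ = -1) (h1 : 1 < α)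
    (h2 : α < 2) (x : ℝ) :
    HasDerivAt (weylMarchaudBar (α - 1) (rayHiggins σ n))
      (phase (σ * α * (Real.pi / 2)) * rayHigginsFrac σ n α x) x := by
  have hβ0 : 0 < α - 1 := by linarith
  have hβ1 : α - 1 < 1 := by linarith
  rw [funext ((hasMarchaudIntegrals_rayHiggins hσ hβ0 hβ1).weylMarchaudBar_eq hβ0 hβ1)]
  refine ((hasDerivAt_rayHigginsFrac σ n hβ0 x).const_mul _).fun_neg.congr_deriv ?_
  rw [sub_add_cancel]
  rcases eq_or_ne n 0 with rfl | hn
  · simp [rayHigginsFrac_zero]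
  have hσ' : -σ = 1 ∨ -σ = -1 := by rcases hσ hn with h | h <;> simp [h]
  have hsq : (σ : ℂ) ^ 2 = 1 := by rcases hσ hn with rfl | rfl <;> simp
  rw [show σ * (α - 1) * (Real.pi / 2) = σ * α * (Real.pi / 2) + -σ * (Real.pi / 2) by ring,
    phase_add, phase_pi_div_two hσ']
  push_cast
  linear_combination (-phase (σ * α * (Real.pi / 2)) * rayHigginsFrac σ n α x) *
    (σ ^ 2 * Complex.I_sq - hsq)

end Derivatives

theorem sign_eq_one_or_neg_one {k : ℤ} (hk : k.natAbs ≠ 0) :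
    (Int.sign k : ℝ) = 1 ∨ (Int.sign k : ℝ) = -1 := by
  rcases lt_or_gt_of_ne (Int.natAbs_ne_zero.mp hk) with h | h
  · exact Or.inr (by rw [Int.sign_eq_neg_one_of_neg h]; norm_num)
  · exact Or.inl (by rw [Int.sign_eq_one_of_pos h]; norm_num)

end

theorem mainTheorem1 (k : ℤ) (x : ℝ) :
    (∀ α : ℝ, 0 < α → α < 1 →
      FracLaplacianConverges α (higgins k) x ∧
      (WeylMarchaudConverges α (higgins k) x ∧
        weylMarchaud α (higgins k) x =
          phase (-(Int.sign k : ℝ) * α * (Real.pi / 2)) * fracLaplacian α (higgins k) x ∧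
        weylMarchaud α (higgins k) x =
          -(phase (-(Int.sign k : ℝ) * α * (Real.pi / 2)) * higginsHypergeometric α k x)) ∧
      (WeylMarchaudBarConverges α (higgins k) x ∧
        weylMarchaudBar α (higgins k) x =
          -(phase ((Int.sign k : ℝ) * α * (Real.pi / 2)) * fracLaplacian α (higgins k) x) ∧
        weylMarchaudBar α (higgins k) x =
          phase ((Int.sign k : ℝ) * α * (Real.pi / 2)) * higginsHypergeometric α k x)) ∧
    (∀ α : ℝ, 1 < α → α < 2 →
      FracLaplacianConverges α (higgins k) x ∧
      ((∀ y : ℝ, WeylMarchaudConverges (α - 1) (higgins k) y) ∧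
        HasDerivAt (weylMarchaud (α - 1) (higgins k))
          (phase (-(Int.sign k : ℝ) * α * (Real.pi / 2)) * fracLaplacian α (higgins k) x) x ∧
        HasDerivAt (weylMarchaud (α - 1) (higgins k))
          (-(phase (-(Int.sign k : ℝ) * α * (Real.pi / 2)) * higginsHypergeometric α k x)) x) ∧
      ((∀ y : ℝ, WeylMarchaudBarConverges (α - 1) (higgins k) y) ∧
        HasDerivAt (weylMarchaudBar (α - 1) (higgins k))
          (phase ((Int.sign k : ℝ) * α * (Real.pi / 2)) * fracLaplacian α (higgins k) x) x ∧
        HasDerivAt (weylMarchaudBar (α - 1) (higgins k))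
          (-(phase ((Int.sign k : ℝ) * α * (Real.pi / 2)) * higginsHypergeometric α k x)) x)) := by
  have hσ := sign_eq_one_or_neg_one (k := k)
  refine ⟨fun α h0 h1 => ?_, fun α h1 h2 => ?_⟩
  · obtain ⟨hc, hv⟩ := fracLaplacian_rayHiggins hσ h0 (h1.trans one_lt_two) h1.ne x
    have hM := hasMarchaudIntegrals_rayHiggins hσ h0 h1
    rw [higginsHypergeometric_eq h0, higgins_eq, hv, hM.weylMarchaud_eq h0 h1,
      hM.weylMarchaudBar_eq h0 h1]
    simp only [mul_neg, neg_neg, and_true]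
    exact ⟨hc, hM.weylMarchaudConverges x, hM.weylMarchaudBarConverges x⟩
  · obtain ⟨hc, hv⟩ := fracLaplacian_rayHiggins hσ (one_pos.trans h1) h2 h1.ne' x
    have hM := hasMarchaudIntegrals_rayHiggins (β := α - 1) hσ (by linarith) (by linarith)
    have hD := hasDerivAt_weylMarchaud_rayHiggins hσ h1 h2 x
    have hDb := hasDerivAt_weylMarchaudBar_rayHiggins hσ h1 h2 x
    rw [higginsHypergeometric_eq (one_pos.trans h1), higgins_eq, hv]
    simp only [mul_neg, neg_neg]
    exact ⟨hc, ⟨hM.weylMarchaudConverges, hD, hD⟩, ⟨hM.weylMarchaudBarConverges, hDb, hDb⟩⟩
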